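/- Let $\mathrm{sOp}$ be the $\mathbb N$-coloured symmetric operad in sets whose algebras are the (single-coloured, unital) symmetric operads: an operation in $\mathrm{sOp}(n_1,\dots,n_k;m)$ is a planar rooted tree with $k$ vertices indexed by $1,\dots,k$, the $i$-th vertex having $n_i$ ordered inputs, and with $m$ non-root leaves indexed by $1,\dots,m$ in arbitrary order (for $k=0$ the only operation is the edge without vertices, with $m=1$); composition is substitution of trees into vertices. For a $C$-coloured symmetric operad $Q$ in sets and a $Q$-algebra $A$, consider expressions $q(x,a_1,\dots,a_n)$, where $q$ is an operation of $Q$, $x$ is one variable, and $a_j\in A$ are elements of the appropriate colours. Let $[q(x,a_1,\dots,a_n)]$ denote the class of such an expression under the equivalence relation generated by compatibility with the action of symmetric groups on the inputs $a_j$ and by $(p\circ_i q)(x,\dots,a_i,\dots,a_{i+l-1},\dots)\sim p(x,\dots,q(a_i,\dots,a_{i+l-1}),\dots)$, i.e. its class in the coproduct of $A$ with a free $Q$-algebra. - The enveloping category $\mathcal U_Q(A)$ has the colours $c\in C$ as objects; the morphisms $c_1\to c_2$ are the classes $[q(h_{c_1},a_1,\dots,a_n)]$ with variable $h_{c_1}$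 of colour $c_1$ and with output colour $c_2$. - The twisted arrow category $\mathrm{Tw}_Q(A)$ has the elements of $A$ as objects; the morphisms $a'_1\to a'_2$ are the classes $[q(a'_1,a_1,\dots,a_n)]$, with $a'_1$ as the variable, whose evaluation $q(a'_1,a_1,\dots,a_n)$ in $A$ is equal to $a'_2$. In both cases the composition is substitution: $[p(y,b_1,\dots,b_l)]\circ[q(x,a_1,\dots,a_n)]=[(p\circ_1 q)(x,a_1,\dots,a_n,b_1,\dots,b_l)]$. These are the underlying categories (the categories of arity one operations) of the enveloping operad and of the twisted arrow operad of $A$. Let $\mathrm{uCom}$ be the terminal symmetric operad, i.e. the terminal $\mathrm{sOp}$-algebra, with exactly one operation in each arity $n\ge 0$. Let $\Gamma$ be Segal's category, the skeleton of the opposite of the category of finite pointed sets: its objects are the sets $[n]=\{0,\dots,n\}$, $n\ge 0$, pointed at $0$, and the morphisms $[n]\to[m]$ in $\Gamma$ are the pointed maps $[m]\to[n]$. **Proposition.** The category $\mathrm{Tw}_{\mathrm{sOp}}(\mathrm{uCom})$ is isomorphic to $\Gamma$, and the category $\mathcal U_{\mathrm{sOp}}(\mathrm{uCom})$ is isomorphic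 to $\Gamma$. -/

import Mathlib

open CategoryTheory

namespace TwArr

universe u v w

/-! ## Index bijections -/

/-- The family on `Option I` with value `b` at `none` and values `c i` at `some i`. -/
abbrev optElim {I : Type} {C : Type u} (b : C) (c : I → C) : Option I → C :=
  fun o => o.elim b c

/-- `(K ⊔ {*}) ⊔ I ≃ (K ⊔ I) ⊔ {*}`. -/
def optSumL (K I : Type) : Option K ⊕ I ≃ Option (K ⊕ I) where
  toFun := fun x => match x with
    | .inl none => none
    | .inl (some k) => some (.inl k)
    | .inr i => some (.inr i)
  invFun := fun x => match x with
    | none => .inl none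
    | some (.inl k) => .inl (some k)
    | some (.inr i) => .inr i
  left_inv := by rintro ((_ | _) | _) <;> rfl
  right_inv := by rintro (_ | (_ | _)) <;> rfl

/-- `K ⊔ (I ⊔ {*}) ≃ (K ⊔ I) ⊔ {*}`. -/
def optSumR (K I : Type) : K ⊕ Option I ≃ Option (K ⊕ I) where
  toFun := fun x => match x with
    | .inl k => some (.inl k)
    | .inr none => none
    | .inr (some i) => some (.inr i)
  invFun := fun x => match x with
    | none => .inr none
    | some (.inl k) => .inl k
    | some (.inr i) => .inr (some i)
  left_inv := by rintro (_ | (_ | _)) <;> rfl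
  right_inv := by rintro (_ | (_ | _)) <;> rfl

/-- The transposition of the two distinguished points of `(I ⊔ {*}) ⊔ {*}`. -/
def optSwap (I : Type) : Option (Option I) ≃ Option (Option I) where
  toFun := fun x => match x with
    | none => some none
    | some none => none
    | some (some i) => some (some i)
  invFun := fun x => match x with
    | none => some none
    | some none => none
    | some (some i) => some (some i)
  left_inv := by rintro (_ | (_ | _)) <;> rfl
  right_inv := by rintro (_ | (_ | _)) <;> rfl

/-- `I ⊔ {*} ≃ {*} ⊔ I`. -/
def optUnit (I : Type) : Option I ≃ Unit ⊕ I where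
  toFun := fun x => match x with
    | none => .inl ()
    | some i => .inr i
  invFun := fun x => match x with
    | .inl _ => none
    | .inr i => some i
  left_inv := by rintro (_ | _) <;> rfl
  right_inv := by rintro (_ | _) <;> rfl

/-- `{*} ≃ ∅ ⊔ {*}`. -/
def unitOpt : Unit ≃ Option Empty where
  toFun := fun _ => none
  invFun := fun _ => ()
  left_inv := fun _ => rfl
  right_inv := by rintro (_ | ⟨⟨⟩⟩); rfl

/-- `K ⊔ (I ⊔ J) ≃ I ⊔ (K ⊔ J)`. -/
def sumLeftComm (K I J : Type) : K ⊕ (I ⊕ J) ≃ I ⊕ (K ⊕ J) where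
  toFun := fun x => match x with
    | .inl k => .inr (.inl k)
    | .inr (.inl i) => .inl i
    | .inr (.inr j) => .inr (.inr j)
  invFun := fun x => match x with
    | .inl i => .inr (.inl i)
    | .inr (.inl k) => .inl k
    | .inr (.inr j) => .inr (.inr j)
  left_inv := by rintro (_ | (_ | _)) <;> rfl
  right_inv := by rintro (_ | (_ | _)) <;> rfl

/-- `(K ⊔ L) ⊔ (I ⊔ J) ≃ (K ⊔ I) ⊔ (L ⊔ J)`. -/
def sumComm4 (K L I J : Type) : (K ⊕ L) ⊕ (I ⊕ J) ≃ (K ⊕ I) ⊕ (L ⊕ J) where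
  toFun := fun x => match x with
    | .inl (.inl k) => .inl (.inl k)
    | .inl (.inr l) => .inr (.inl l)
    | .inr (.inl i) => .inl (.inr i)
    | .inr (.inr j) => .inr (.inr j)
  invFun := fun x => match x with
    | .inl (.inl k) => .inl (.inl k)
    | .inr (.inl l) => .inl (.inr l)
    | .inl (.inr i) => .inr (.inl i)
    | .inr (.inr j) => .inr (.inr j)
  left_inv := by rintro ((_ | _) | (_ | _)) <;> rfl
  right_inv := by rintro ((_ | _) | (_ | _)) <;> rfl

/-! Compatibility of these bijections with colours. -/

section Colours

variable {C : Type u} {I I' K K' L J : Type}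

theorem col_refl {c : I → C} (i : I) : c (Equiv.refl I i) = c i := rfl

theorem col_trans {c : I → C} {c' : K → C} {c'' : L → C} {e : I ≃ K} {e' : K ≃ L}
    (h : ∀ i, c' (e i) = c i) (h' : ∀ j, c'' (e' j) = c' j) (i : I) :
    c'' ((e.trans e') i) = c i := (h' (e i)).trans (h i)

theorem col_optionCongr {c : I → C} {c' : I' → C} {b : C} {e : I ≃ I'}
    (h : ∀ i, c' (e i) = c i) (o : Option I) :
    optElim b c' (e.optionCongr o) = optElim b c o := by
  rcases o with _ | i
  exacts [rfl, h i]

theorem col_sumCongr {c : I → C} {c' : I' → C} {d : K → C} {d' : K' → C} {e : I ≃ I'}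
    {f : K ≃ K'} (h : ∀ i, c' (e i) = c i) (k : ∀ i, d' (f i) = d i) (x : I ⊕ K) :
    Sum.elim c' d' (Equiv.sumCongr e f x) = Sum.elim c d x := by
  rcases x with i | i
  exacts [h i, k i]

theorem col_optUnit {b : C} {c : I → C} (o : Option I) :
    Sum.elim (fun _ => b) c (optUnit I o) = optElim b c o := by
  rcases o with _ | _ <;> rfl

theorem col_unitOpt {b : C} (x : Unit) :
    optElim b (Empty.elim : Empty → C) (unitOpt x) = b := rfl

theorem col_sumEmpty_symm {d : K → C} (k : K) :
    Sum.elim d (Empty.elim : Empty → C) ((Equiv.sumEmpty K Empty).symm k) = d k := rfl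

theorem col_sumEmpty {d : K → C} (x : K ⊕ Empty) :
    d (Equiv.sumEmpty K Empty x) = Sum.elim d (Empty.elim : Empty → C) x := by
  rcases x with _ | ⟨⟨⟩⟩; rfl

theorem col_emptySum {d : K → C} (x : Empty ⊕ K) :
    d (Equiv.emptySum Empty K x) = Sum.elim (Empty.elim : Empty → C) d x := by
  rcases x with ⟨⟨⟩⟩ | _; rfl

theorem col_sumAssoc {f : L → C} {d : K → C} {c : I → C} (x : (L ⊕ K) ⊕ I) :
    Sum.elim f (Sum.elim d c) (Equiv.sumAssoc L K I x) = Sum.elim (Sum.elim f d) c x := by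
  rcases x with (_ | _) | _ <;> rfl

theorem col_sumAssoc_symm {f : L → C} {d : K → C} {c : I → C} (x : L ⊕ (K ⊕ I)) :
    Sum.elim (Sum.elim f d) c ((Equiv.sumAssoc L K I).symm x) = Sum.elim f (Sum.elim d c) x := by
  rcases x with _ | (_ | _) <;> rfl

theorem col_optSumL {b : C} {d : K → C} {c : I → C} (x : Option K ⊕ I) :
    optElim b (Sum.elim d c) (optSumL K I x) = Sum.elim (optElim b d) c x := by
  rcases x with (_ | _) | _ <;> rfl

theorem col_optSumR {b : C} {d : K → C} {c : I → C} (x : K ⊕ Option I) :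
    optElim b (Sum.elim d c) (optSumR K I x) = Sum.elim d (optElim b c) x := by
  rcases x with _ | (_ | _) <;> rfl

theorem col_optSumR_symm {b : C} {d : K → C} {c : I → C} (x : Option (K ⊕ I)) :
    Sum.elim d (optElim b c) ((optSumR K I).symm x) = optElim b (Sum.elim d c) x := by
  rcases x with _ | (_ | _) <;> rfl

theorem col_optSwap {b b' : C} {c : I → C} (x : Option (Option I)) :
    optElim b' (optElim b c) (optSwap I x) = optElim b (optElim b' c) x := by
  rcases x with _ | (_ | _) <;> rfl

theorem col_sumLeftComm {f : L → C} {d : K → C} {c : I → C} (x : K ⊕ (L ⊕ I)) :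
    Sum.elim f (Sum.elim d c) (sumLeftComm K L I x) = Sum.elim d (Sum.elim f c) x := by
  rcases x with _ | (_ | _) <;> rfl

theorem col_sumComm4 {k : K → C} {l : L → C} {c : I → C} {d : J → C}
    (x : (K ⊕ L) ⊕ (I ⊕ J)) :
    Sum.elim (Sum.elim k c) (Sum.elim l d) (sumComm4 K L I J x) =
      Sum.elim (Sum.elim k l) (Sum.elim c d) x := by
  rcases x with (_ | _) | (_ | _) <;> rfl

end Colours

/-! ## Coloured symmetric operads in sets -/

/-- A `C`-coloured symmetric operad in sets with identity operations, in coordinate-free form: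
the inputs of an operation are indexed by an arbitrary finite set `I` (with colours `c : I → C`),
`map` is the relabelling of inputs along colour-preserving bijections (for `I = Fin n` this is
the action of the symmetric group), and `comp p q` is the partial composition, the substitution
of `q` into the distinguished input `none` of `p`. The axioms are functoriality of relabelling,
its compatibility with partial composition, the two unit laws, and sequential and parallel
associativity. -/
structure Operad (C : Type u) where
  Op : (I : Type) → [Finite I] → (I → C) → C → Type v
  map : {I J : Type} → [Finite I] → [Finite J] → {c : I → C} → {c' : J → C} → {c₀ : C} →
    (e : I ≃ J) → (∀ i, c' (e i) = c i) → Op I c c₀ → Op J c' c₀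
  one : (b : C) → Op Unit (fun _ => b) b
  comp : {I K : Type} → [Finite I] → [Finite K] → {c : I → C} → {d : K → C} → {b c₀ : C} →
    Op (Option I) (optElim b c) c₀ → Op K d b → Op (K ⊕ I) (Sum.elim d c) c₀
  map_refl : ∀ {I : Type} [Finite I] {c : I → C} {c₀ : C} (p : Op I c c₀),
    map (Equiv.refl I) col_refl p = p
  map_map : ∀ {I J K : Type} [Finite I] [Finite J] [Finite K]
    {c : I → C} {c' : J → C} {c'' : K → C} {c₀ : C}
    (e : I ≃ J) (h : ∀ i, c' (e i) = c i) (e' : J ≃ K) (h' : ∀ j, c'' (e' j) = c' j)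
    (p : Op I c c₀),
    map e' h' (map e h p) = map (e.trans e') (col_trans h h') p
  comp_map : ∀ {I I' K K' : Type} [Finite I] [Finite I'] [Finite K] [Finite K']
    {c : I → C} {c' : I' → C} {d : K → C} {d' : K' → C} {b c₀ : C}
    (e : I ≃ I') (h : ∀ i, c' (e i) = c i) (f : K ≃ K') (k : ∀ i, d' (f i) = d i)
    (p : Op (Option I) (optElim b c) c₀) (q : Op K d b),
    comp (map e.optionCongr (col_optionCongr h) p) (map f k q) =
      map (Equiv.sumCongr f e) (col_sumCongr k h) (comp p q)
  comp_one : ∀ {I : Type} [Finite I] {c : I → C} {b c₀ : C}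
    (p : Op (Option I) (optElim b c) c₀),
    comp p (one b) = map (optUnit I) col_optUnit p
  one_comp : ∀ {K : Type} [Finite K] {d : K → C} {b : C} (q : Op K d b),
    comp (map unitOpt col_unitOpt (one b)) q =
      map (Equiv.sumEmpty K Empty).symm col_sumEmpty_symm q
  comp_comp : ∀ {I K L : Type} [Finite I] [Finite K] [Finite L]
    {c : I → C} {d : K → C} {f : L → C} {b b' c₀ : C}
    (p : Op (Option I) (optElim b c) c₀) (q : Op (Option K) (optElim b' d) b) (r : Op L f b'),
    comp p (comp q r) =
      map (Equiv.sumAssoc L K I).symm col_sumAssoc_symm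
        (comp (map (optSumL K I) col_optSumL (comp p q)) r)
  comp_comm : ∀ {I K L : Type} [Finite I] [Finite K] [Finite L]
    {c : I → C} {d : K → C} {f : L → C} {b b' c₀ : C}
    (p : Op (Option (Option I)) (optElim b (optElim b' c)) c₀) (q : Op K d b) (r : Op L f b'),
    comp (map (optSumR K I) col_optSumR (comp p q)) r =
      map (sumLeftComm K L I) col_sumLeftComm
        (comp (map (optSumR L I) col_optSumR
          (comp (map (optSwap I) col_optSwap p) r)) q)

namespace Operad

variable {C : Type u} (P : Operad.{u, v} C)

theorem map_congr {I J : Type} [Finite I] [Finite J] {c : I → C} {c' : J → C} {c₀ : C}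
    {e e' : I ≃ J} {h : ∀ i, c' (e i) = c i} {h' : ∀ i, c' (e' i) = c i}
    (he : ∀ i, e i = e' i) (p : P.Op I c c₀) : P.map e h p = P.map e' h' p := by
  have : e = e' := Equiv.ext he
  subst this; rfl

theorem map_eq_self {I : Type} [Finite I] {c : I → C} {c₀ : C}
    {e : I ≃ I} {h : ∀ i, c (e i) = c i} (he : ∀ i, e i = i) (p : P.Op I c c₀) :
    P.map e h p = p :=
  (P.map_congr (e' := Equiv.refl I) (h' := fun _ => rfl) he p).trans (P.map_refl p)

theorem comp_map_left {I I' K : Type} [Finite I] [Finite I'] [Finite K]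
    {c : I → C} {c' : I' → C} {d : K → C} {b c₀ : C}
    {g : Option I ≃ Option I'} {hg : ∀ o, optElim b c' (g o) = optElim b c o}
    (e : I ≃ I') (h : ∀ i, c' (e i) = c i) (he : ∀ o, g o = e.optionCongr o)
    (p : P.Op (Option I) (optElim b c) c₀) (q : P.Op K d b) :
    P.comp (P.map g hg p) q =
      P.map (Equiv.sumCongr (Equiv.refl K) e) (col_sumCongr col_refl h) (P.comp p q) := by
  rw [← P.comp_map e h (Equiv.refl K) col_refl p q, P.map_refl]
  congr 1
  exact P.map_congr he p

theorem comp_map_right {I K K' : Type} [Finite I] [Finite K] [Finite K']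
    {c : I → C} {d : K → C} {d' : K' → C} {b c₀ : C}
    {f : K ≃ K'} {k : ∀ i, d' (f i) = d i}
    (p : P.Op (Option I) (optElim b c) c₀) (q : P.Op K d b) :
    P.comp p (P.map f k q) =
      P.map (Equiv.sumCongr f (Equiv.refl I)) (col_sumCongr k col_refl) (P.comp p q) := by
  rw [← P.comp_map (Equiv.refl I) col_refl f k p q]
  congr 1
  exact (P.map_eq_self (by rintro (_ | _) <;> rfl) p).symm

theorem comp_map_shift {X I I' K : Type} [Finite X] [Finite I] [Finite I'] [Finite K]
    {x : X → C} {c : I → C} {c' : I' → C} {d : K → C} {b c₀ : C}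
    {g' : X ≃ Option I'} {hg' : ∀ o, optElim b c' (g' o) = x o}
    (g : X ≃ Option I) (hg : ∀ o, optElim b c (g o) = x o)
    (e : I ≃ I') (h : ∀ i, c' (e i) = c i) (he : ∀ o, g' o = e.optionCongr (g o))
    (p : P.Op X x c₀) (q : P.Op K d b) :
    P.comp (P.map g' hg' p) q =
      P.map (Equiv.sumCongr (Equiv.refl K) e) (col_sumCongr col_refl h)
        (P.comp (P.map g hg p) q) := by
  rw [← P.comp_map_left (hg := col_optionCongr h) e h (fun _ => rfl), P.map_map]
  congr 1
  exact P.map_congr he p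

theorem map_comp_congr {X I I' K Z : Type} [Finite X] [Finite I] [Finite I'] [Finite K] [Finite Z]
    {x : X → C} {c : I → C} {c' : I' → C} {d : K → C} {z : Z → C} {b c₀ : C}
    {g : X ≃ Option I} {hg : ∀ o, optElim b c (g o) = x o}
    {g' : X ≃ Option I'} {hg' : ∀ o, optElim b c' (g' o) = x o}
    {s : K ⊕ I ≃ Z} {hs : ∀ i, z (s i) = Sum.elim d c i}
    {s' : K ⊕ I' ≃ Z} {hs' : ∀ i, z (s' i) = Sum.elim d c' i}
    (e : I ≃ I') (h : ∀ i, c' (e i) = c i) (he : ∀ o, g' o = e.optionCongr (g o))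
    (hss : ∀ i, s i = s' (Equiv.sumCongr (Equiv.refl K) e i))
    (p : P.Op X x c₀) (q : P.Op K d b) :
    P.map s hs (P.comp (P.map g hg p) q) = P.map s' hs' (P.comp (P.map g' hg' p) q) := by
  rw [P.comp_map_shift g hg e h he, P.map_map]
  exact P.map_congr hss _

/-- The objects of the underlying category of an operad: its colours. -/
structure Underlying (P : Operad.{u, v} C) : Type u where
  colour : C

/-- The underlying category of an operad: the category of operations of arity one. -/
instance underlyingCategory : Category.{v} P.Underlying where
  Hom a b := P.Op Unit (fun _ => a.colour) b.colour
  id a := P.one a.colour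
  comp {a b c} f g := P.map (Equiv.sumEmpty Unit Empty) (col_sumEmpty (d := fun _ => a.colour))
    (P.comp (P.map unitOpt (col_unitOpt (b := b.colour)) g) f)
  id_comp f := by
    rw [P.comp_one, P.map_map, P.map_map]
    exact P.map_eq_self (fun _ => rfl) f
  comp_id f := by
    rw [P.one_comp, P.map_map]
    exact P.map_eq_self (fun _ => rfl) f
  assoc {a b c d} f g h := by
    let e : Empty ≃ Empty ⊕ Empty := (Equiv.sumEmpty Empty Empty).symm
    have he : ∀ i, (Sum.elim Empty.elim Empty.elim : Empty ⊕ Empty → C) (e i) = Empty.elim i := by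
      rintro ⟨⟩
    rw [P.map_map, P.comp_map_right, P.comp_comp, P.comp_map_right,
      P.map_map, P.map_map, P.map_map]
    have key := P.comp_map_left (hg := col_optionCongr (b := b.colour) he) e he
      (fun _ => rfl) (P.map ((Equiv.sumEmpty Unit Empty).trans unitOpt)
        (col_trans (col_sumEmpty (d := fun _ => b.colour)) col_unitOpt)
        (P.comp (P.map unitOpt (col_unitOpt (b := c.colour)) h) g)) f
    rw [P.map_map] at key
    rw [P.map_congr (e' := ((Equiv.sumEmpty Unit Empty).trans unitOpt).trans e.optionCongr)
      (h' := col_trans (col_trans (col_sumEmpty (d := fun _ => b.colour)) col_unitOpt)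
        (col_optionCongr he)) (by rintro (_ | ⟨⟨⟩⟩); rfl), key, P.map_map]
    exact P.map_congr (by rintro (_ | ⟨⟨⟩⟩); rfl) _

end Operad

/-! ## Algebras over operads -/

section Families

variable {C : Type u} {I J : Type} {X : C → Type w}

/-- A family over `Option I` from its values at `none` and on `I`. -/
def optFam {b : C} {c : I → C} (x : X b) (y : ∀ i, X (c i)) : ∀ o, X (optElim b c o)
  | none => x
  | some i => y i

/-- A family over `I ⊔ J` from its restrictions to `I` and to `J`. -/
def sumFam {c : I → C} {d : J → C} (x : ∀ i, X (c i)) (y : ∀ j, X (d j)) :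
    ∀ s, X (Sum.elim c d s)
  | .inl i => x i
  | .inr j => y j

/-- Pull back a family along a colour-preserving map. -/
def pullFam {c : I → C} {d : J → C} (e : I → J) (h : ∀ i, d (e i) = c i) (x : ∀ j, X (d j)) :
    ∀ i, X (c i) :=
  fun i => cast (congrArg X (h i)) (x (e i))

theorem pullFam_heq {c : I → C} {d : J → C} (e : I → J) (h : ∀ i, d (e i) = c i)
    (x : ∀ j, X (d j)) (i : I) : HEq (pullFam e h x i) (x (e i)) := cast_heq _ _

end Families

/-- An algebra over a coloured operad in sets. -/
structure Algebra {C : Type u} (Q : Operad.{u, v} C) where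
  carrier : C → Type w
  act : {I : Type} → [Finite I] → {c : I → C} → {c₀ : C} →
    Q.Op I c c₀ → (∀ i, carrier (c i)) → carrier c₀
  act_map : ∀ {I J : Type} [Finite I] [Finite J] {c : I → C} {c' : J → C} {c₀ : C}
    (e : I ≃ J) (h : ∀ i, c' (e i) = c i) (q : Q.Op I c c₀) (x : ∀ j, carrier (c' j)),
    act (Q.map e h q) x = act q (pullFam e h x)
  act_one : ∀ (b : C) (x : Unit → carrier b), act (Q.one b) x = x ()
  act_comp : ∀ {I K : Type} [Finite I] [Finite K] {c : I → C} {d : K → C} {b c₀ : C}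
    (p : Q.Op (Option I) (optElim b c) c₀) (q : Q.Op K d b)
    (x : ∀ k, carrier (d k)) (y : ∀ i, carrier (c i)),
    act (Q.comp p q) (sumFam x y) = act p (optFam (act q x) y)

/-! ## The enveloping operad -/

section Enveloping

variable {C : Type u} {Q : Operad.{u, v} C} (A : Algebra.{u, v, w} Q)

/-- An expression `q(h_{c 1}, …, h_{c m}, a_1, …, a_n)`: an operation `q` of `Q`, whose inputs
are split into the set `I` of variables and a finite set `J`, and elements `a_j` of `A` of the
colours of the inputs `j ∈ J`. -/
structure Expr {I : Type} [Finite I] (c : I → C) (c₀ : C) where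
  J : Type
  [fin : Finite J]
  d : J → C
  op : Q.Op (I ⊕ J) (Sum.elim c d) c₀
  elts : ∀ j, A.carrier (d j)

attribute [instance] Expr.fin

/-- The relations that define the coproduct of `A` with a free algebra, on expressions in which
the variables `h_i`, `i ∈ I`, occur once each: `[q^σ(h, a_σ)] = [q(h, a)]` for a relabelling `σ`
of the inputs `J`, and
`[(q ∘ p)(h, x, y)] = [q(h, p(x), y)]` where the elements `x`, `y` are in `A`. -/
inductive Expr.Rel {I : Type} [Finite I] {c : I → C} {c₀ : C} :
    Expr A c c₀ → Expr A c c₀ → Prop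
  | relabel {J J' : Type} [Finite J] [Finite J'] (e : J ≃ J') (d : J' → C)
      (q : Q.Op (I ⊕ J) (Sum.elim c (fun j => d (e j))) c₀) (a : ∀ j, A.carrier (d j)) :
      Expr.Rel
        ⟨J', d, Q.map (Equiv.sumCongr (Equiv.refl I) e)
          (col_sumCongr col_refl (fun _ => rfl)) q, a⟩
        ⟨J, fun j => d (e j), q, fun j => a (e j)⟩
  | contract {J K : Type} [Finite J] [Finite K] {d : J → C} {k : K → C} {b : C}
      (q : Q.Op (Option (I ⊕ J)) (optElim b (Sum.elim c d)) c₀) (p : Q.Op K k b)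
      (x : ∀ i, A.carrier (k i)) (y : ∀ j, A.carrier (d j)) :
      Expr.Rel
        ⟨K ⊕ J, Sum.elim k d, Q.map (sumLeftComm K I J) col_sumLeftComm (Q.comp q p),
          sumFam x y⟩
        ⟨Option J, optElim b d, Q.map (optSumR I J).symm col_optSumR_symm q,
          optFam (A.act p x) y⟩

/-- The operations of the enveloping operad: the classes `[q(h_{c 1}, …, h_{c m}, a_1, …, a_n)]`
of expressions for the equivalence relation generated by `Expr.Rel`. -/
def EnvOp (I : Type) [Finite I] (c : I → C) (c₀ : C) : Type (max 1 u v w) :=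
  Quot (Expr.Rel A (c := c) (c₀ := c₀))

variable {A}

theorem env_sound {I : Type} [Finite I] {c : I → C} {c₀ : C} {J J' : Type} [Finite J] [Finite J']
    {d : J → C} {d' : J' → C} {q : Q.Op (I ⊕ J) (Sum.elim c d) c₀}
    {q' : Q.Op (I ⊕ J') (Sum.elim c d') c₀}
    {a : ∀ j, A.carrier (d j)} {a' : ∀ j, A.carrier (d' j)}
    (e : J ≃ J') (h : ∀ j, d' (e j) = d j)
    (hq : Q.map (Equiv.sumCongr (Equiv.refl I) e) (col_sumCongr col_refl h) q = q')
    (ha : ∀ j, HEq (a j) (a' (e j))) :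
    (Quot.mk _ ⟨J, d, q, a⟩ : EnvOp A I c c₀) = Quot.mk _ ⟨J', d', q', a'⟩ := by
  obtain rfl : d = fun j => d' (e j) := funext fun j => (h j).symm
  obtain rfl : a = fun j => a' (e j) := funext fun j => eq_of_heq (ha j)
  subst hq
  exact (Quot.sound (Expr.Rel.relabel e d' q a')).symm

/-- Relabelling of the variables of an expression. -/
abbrev Expr.map {I I' : Type} [Finite I] [Finite I'] {c : I → C} {c' : I' → C} {c₀ : C}
    (e : I ≃ I') (h : ∀ i, c' (e i) = c i) (p : Expr A c c₀) : Expr A c' c₀ :=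
  ⟨p.J, p.d, Q.map (Equiv.sumCongr e (Equiv.refl p.J)) (col_sumCongr h col_refl) p.op, p.elts⟩

/-- `p(h, h_1, …, h_m, a) ∘ q(h_1', …, h_k', b) = (p ∘ q)(h_1', …, h_k', h_1, …, h_m, b, a)`. -/
abbrev Expr.comp {I K : Type} [Finite I] [Finite K] {c : I → C} {d : K → C} {b c₀ : C}
    (p : Expr A (optElim b c) c₀) (q : Expr A d b) : Expr A (Sum.elim d c) c₀ :=
  ⟨q.J ⊕ p.J, Sum.elim q.d p.d,
    Q.map (sumComm4 K q.J I p.J) col_sumComm4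
      (Q.comp (Q.map (optSumL I p.J) col_optSumL p.op) q.op),
    sumFam q.elts p.elts⟩

theorem Expr.map_rel {I I' : Type} [Finite I] [Finite I'] {c : I → C} {c' : I' → C} {c₀ : C}
    (e : I ≃ I') (h : ∀ i, c' (e i) = c i) {p p' : Expr A c c₀} (hr : Expr.Rel A p p') :
    (Quot.mk _ (p.map e h) : EnvOp A I' c' c₀) = Quot.mk _ (p'.map e h) := by
  rcases hr with ⟨f, d, q, a⟩ | ⟨q, p, x, y⟩
  · refine (env_sound f (fun _ => rfl) ?_ (fun _ => HEq.rfl)).symm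
    dsimp only
    rw [Q.map_map, Q.map_map]
    exact Q.map_congr (by rintro (_ | _) <;> rfl) _
  · rename_i J K _ _ d k b
    have key := Quot.sound (Expr.Rel.contract (A := A)
      (Q.map (Equiv.sumCongr e (Equiv.refl J)).optionCongr
        (col_optionCongr (b := b) (col_sumCongr h (col_refl (c := d)))) q) p x y)
    refine Eq.trans ?_ (key.trans ?_)
    · rw [Q.comp_map_left _ (col_sumCongr h (col_refl (c := d))) (fun _ => rfl), Q.map_map]
      refine env_sound (Equiv.refl _) (fun _ => rfl) ?_ (fun _ => HEq.rfl)
      dsimp only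
      rw [Q.map_map, Q.map_map]
      exact Q.map_congr (by rintro (_ | (_ | _)) <;> rfl) _
    · refine env_sound (Equiv.refl _) (fun _ => rfl) ?_ (fun _ => HEq.rfl)
      dsimp only
      rw [Q.map_map, Q.map_map, Q.map_map]
      exact Q.map_congr (by rintro (_ | (_ | _)) <;> rfl) _

theorem Expr.comp_rel_left {I K : Type} [Finite I] [Finite K] {c : I → C} {d : K → C} {b c₀ : C}
    {p p' : Expr A (optElim b c) c₀} (hr : Expr.Rel A p p') (q : Expr A d b) :
    (Quot.mk _ (p.comp q) : EnvOp A (K ⊕ I) (Sum.elim d c) c₀) = Quot.mk _ (p'.comp q) := by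
  rcases hr with ⟨f, d', s, a⟩ | ⟨s, t, x, y⟩
  · rename_i J J' _ _
    refine (env_sound (Equiv.sumCongr (Equiv.refl q.J) f)
      (col_sumCongr col_refl (fun _ => rfl)) ?_ (by rintro (_ | _) <;> exact HEq.rfl)).symm
    dsimp only
    rw [Q.map_map, Q.map_map, Q.comp_map_shift (optSumL I J) (col_optSumL (b := b))
      (Equiv.sumCongr (Equiv.refl I) f) (col_sumCongr col_refl fun _ => rfl)
      (by rintro ((_ | _) | _) <;> rfl), Q.map_map]
    exact Q.map_congr (by rintro ((_ | _) | (_ | _)) <;> rfl) _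
  · rename_i J L _ _ d' k b'
    let s₁ := Q.map (optSumL I J).optionCongr
      (col_optionCongr (b := b') (col_optSumL (b := b) (d := c) (c := d'))) s
    let u₀ := Q.map (optSumR (K ⊕ q.J) (I ⊕ J)) col_optSumR
      (Q.comp (Q.map (optSwap (I ⊕ J)) col_optSwap s₁) q.op)
    let u := Q.map (sumComm4 K q.J I J).optionCongr (col_optionCongr (b := b') col_sumComm4) u₀
    have key := Quot.sound (Expr.Rel.contract (A := A) u t x (sumFam q.elts y))
    have hc := Q.comp_comm s₁ t q.op
    change _ = Q.map _ _ (Q.comp u₀ t) at hc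
    refine Eq.trans ?_ (key.trans ?_)
    · refine env_sound (sumLeftComm q.J L J) col_sumLeftComm ?_
        (by rintro (_ | (_ | _)) <;> exact HEq.rfl)
      dsimp only [Expr.comp, u]
      rw [Q.comp_map_left (sumComm4 K q.J I J) col_sumComm4 (fun _ => rfl), Q.map_map]
      rw [Q.comp_map_left (optSumL I J) col_optSumL (fun _ => rfl), Q.map_map] at hc
      rw [Q.map_map (sumLeftComm L (Option I) J),
        Q.comp_map_shift (((Equiv.refl L).sumCongr (optSumL I J)).trans (optSumR L (I ⊕ J)))
          (col_trans (col_sumCongr (col_refl (c := k)) (col_optSumL (b := b) (c := d')))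
            col_optSumR) (sumLeftComm L I J) col_sumLeftComm
          (by rintro (_ | ((_ | _) | _)) <;> rfl) (Q.comp s t) q.op, hc, Q.map_map, Q.map_map,
        Q.map_map]
      exact Q.map_congr (by rintro (_ | ((_ | _) | (_ | _))) <;> rfl) _
    · refine (env_sound (optSumR q.J J) col_optSumR ?_
        (by rintro (_ | (_ | _)) <;> exact HEq.rfl)).symm
      dsimp only [Expr.comp, u, u₀, s₁]
      rw [Q.map_map (optSumL I J).optionCongr, Q.map_map (optSumR (Option I) J).symm,
        Q.comp_map_shift ((optSumL I J).optionCongr.trans (optSwap (I ⊕ J)))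
          (col_trans (col_optionCongr (b := b') (col_optSumL (b := b) (d := c) (c := d')))
            col_optSwap) (optSumR I J).symm col_optSumR_symm
          (by rintro (_ | ((_ | _) | _)) <;> rfl) s q.op]
      simp only [Q.map_map]
      exact Q.map_congr (by rintro ((_ | _) | (_ | (_ | _))) <;> rfl) _

theorem Expr.comp_rel_right {I K : Type} [Finite I] [Finite K] {c : I → C} {d : K → C} {b c₀ : C}
    (p : Expr A (optElim b c) c₀) {q q' : Expr A d b} (hr : Expr.Rel A q q') :
    (Quot.mk _ (p.comp q) : EnvOp A (K ⊕ I) (Sum.elim d c) c₀) = Quot.mk _ (p.comp q') := by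
  rcases hr with ⟨f, d', s, a⟩ | ⟨s, t, x, y⟩
  · refine (env_sound (Equiv.sumCongr f (Equiv.refl p.J))
      (col_sumCongr (fun _ => rfl) col_refl) ?_ (by rintro (_ | _) <;> exact HEq.rfl)).symm
    dsimp only
    rw [Q.comp_map_right, Q.map_map, Q.map_map]
    exact Q.map_congr (by rintro ((_ | _) | (_ | _)) <;> rfl) _
  · rename_i J L _ _ d' k b'
    let P := Q.map (optSumL I p.J) (col_optSumL (b := b) (d := c) (c := p.d)) p.op
    let u₀ := Q.map (optSumL (K ⊕ J) (I ⊕ p.J)) col_optSumL (Q.comp P s)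
    let u := Q.map (sumComm4 K J I p.J).optionCongr (col_optionCongr (b := b') col_sumComm4) u₀
    have key := Quot.sound (Expr.Rel.contract (A := A) u t x (sumFam y p.elts))
    have hc := Q.comp_comp P s t
    change _ = Q.map _ _ (Q.comp u₀ t) at hc
    refine Eq.trans ?_ (key.trans ?_)
    · refine env_sound (Equiv.sumAssoc L J p.J)
        (by rintro ((_ | _) | _) <;> rfl) ?_ (by rintro ((_ | _) | _) <;> exact HEq.rfl)
      dsimp only [Expr.comp, u]
      rw [Q.comp_map_left (sumComm4 K J I p.J) col_sumComm4 (fun _ => rfl), Q.comp_map_right, hc]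
      simp only [Q.map_map]
      exact Q.map_congr (by rintro (_ | ((_ | _) | (_ | _))) <;> rfl) _
    · refine (env_sound (optSumL J p.J) col_optSumL ?_
        (by rintro ((_ | _) | _) <;> exact HEq.rfl)).symm
      dsimp only [Expr.comp, u, u₀, P]
      rw [Q.comp_map_right]
      simp only [Q.map_map]
      exact Q.map_congr (by rintro ((_ | (_ | _)) | (_ | _)) <;> rfl) _

/-- The identity expression `id_b(h_b)`. -/
abbrev Expr.one (A : Algebra.{u, v, w} Q) (b : C) : Expr A (fun _ : Unit => b) b :=
  ⟨Empty, Empty.elim, Q.map (Equiv.sumEmpty Unit Empty).symm col_sumEmpty_symm (Q.one b),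
    fun j => j.elim⟩

/-- Relabelling of variables in the enveloping operad. -/
def EnvOp.map {I I' : Type} [Finite I] [Finite I'] {c : I → C} {c' : I' → C} {c₀ : C}
    (e : I ≃ I') (h : ∀ i, c' (e i) = c i) : EnvOp A I c c₀ → EnvOp A I' c' c₀ :=
  Quot.lift (fun p => Quot.mk _ (p.map e h)) (fun _ _ => Expr.map_rel e h)

/-- Composition in the enveloping operad. -/
def EnvOp.comp {I K : Type} [Finite I] [Finite K] {c : I → C} {d : K → C} {b c₀ : C}
    (p : EnvOp A (Option I) (optElim b c) c₀) (q : EnvOp A K d b) :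
    EnvOp A (K ⊕ I) (Sum.elim d c) c₀ :=
  Quot.lift (fun p => Quot.lift (fun q => Quot.mk _ (Expr.comp p q))
      (fun _ _ hr => Expr.comp_rel_right p hr))
    (fun p p' hr => funext fun q => by
      induction q using Quot.ind with
      | mk q => exact Expr.comp_rel_left hr q) p q

variable (A)

/-- The enveloping operad `UOp_Q(A)`: its operations of input colours `c` and output colour `c₀`
are the classes of expressions `q(h_{c 1}, …, h_{c m}, a_1, …, a_n)` in the coproduct of `A` with
the free `Q`-algebra on variables `h_c`, and composition is substitution of expressions. -/
def envelopingOperad : Operad.{u, max 1 u v w} C where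
  Op := fun I _ c c₀ => EnvOp A I c c₀
  map := EnvOp.map
  one := fun b => Quot.mk _ (Expr.one A b)
  comp := EnvOp.comp
  map_refl := by
    intro I _ c c₀ p
    induction p using Quot.ind with | mk p
    obtain ⟨Jp, dp, p, ap⟩ := p
    refine env_sound (Equiv.refl _) col_refl ?_ (fun _ => HEq.rfl)
    dsimp only [Expr.map]
    rw [Q.map_map]
    exact Q.map_eq_self (by rintro (_ | _) <;> rfl) _
  map_map := by
    intro I J K _ _ _ c c' c'' c₀ e h e' h' p
    induction p using Quot.ind with | mk p
    obtain ⟨Jp, dp, p, ap⟩ := p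
    refine env_sound (Equiv.refl _) col_refl ?_ (fun _ => HEq.rfl)
    dsimp only [Expr.map]
    rw [Q.map_map, Q.map_map]
    exact Q.map_congr (by rintro (_ | _) <;> rfl) _
  comp_map := by
    intro I I' K K' _ _ _ _ c c' d d' b c₀ e h f k p q
    induction p using Quot.ind with | mk p
    obtain ⟨Jp, dp, p, ap⟩ := p
    induction q using Quot.ind with | mk q
    obtain ⟨Jq, dq, q, aq⟩ := q
    refine env_sound (Equiv.refl _) col_refl ?_ (fun _ => HEq.rfl)
    dsimp only [Expr.map, Expr.comp]
    rw [Q.comp_map_right, Q.map_map (e := Equiv.sumCongr e.optionCongr (Equiv.refl Jp)),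
      Q.comp_map_shift (optSumL I Jp) (col_optSumL (b := b)) (Equiv.sumCongr e (Equiv.refl Jp))
        (col_sumCongr h col_refl) (by rintro ((_ | _) | _) <;> rfl)]
    simp only [Q.map_map]
    exact Q.map_congr (by rintro ((_ | _) | (_ | _)) <;> rfl) _
  comp_one := by
    intro I _ c b c₀ p
    induction p using Quot.ind with | mk p
    obtain ⟨Jp, dp, p, ap⟩ := p
    refine env_sound (Equiv.emptySum Empty Jp) col_emptySum ?_
      (by rintro (⟨⟨⟩⟩ | _); exact HEq.rfl)
    dsimp only [Expr.map, Expr.comp, Expr.one]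
    rw [Q.comp_map_right, Q.comp_one]
    simp only [Q.map_map]
    exact Q.map_congr (by rintro ((_ | _) | _) <;> rfl) _
  one_comp := by
    intro K _ d b q
    induction q using Quot.ind with | mk q
    obtain ⟨Jq, dq, q, aq⟩ := q
    refine env_sound (Equiv.sumEmpty Jq Empty) col_sumEmpty ?_
      (by rintro (_ | ⟨⟨⟩⟩); exact HEq.rfl)
    dsimp only [Expr.map, Expr.comp, Expr.one]
    have h : ∀ i : Empty, (Sum.elim Empty.elim Empty.elim : Empty ⊕ Empty → C)
        ((Equiv.sumEmpty Empty Empty).symm i) = Empty.elim i := by rintro ⟨⟩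
    simp only [Q.map_map]
    rw [Q.comp_map_shift unitOpt (col_unitOpt (b := b))
      (Equiv.sumEmpty Empty Empty).symm h (fun _ => rfl), Q.one_comp]
    simp only [Q.map_map]
    exact Q.map_congr (by rintro (_ | _) <;> rfl) _
  comp_comp := by
    intro I K L _ _ _ c d f b b' c₀ p q r
    induction p using Quot.ind with | mk p
    obtain ⟨Jp, dp, p, ap⟩ := p
    induction q using Quot.ind with | mk q
    obtain ⟨Jq, dq, q, aq⟩ := q
    induction r using Quot.ind with | mk r
    obtain ⟨Jr, dr, r, ar⟩ := r
    refine env_sound (Equiv.sumAssoc Jr Jq Jp) col_sumAssoc ?_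
      (by rintro ((_ | _) | _) <;> exact HEq.rfl)
    dsimp only [Expr.map, Expr.comp]
    rw [Q.comp_map_right _ (Q.comp _ _), Q.comp_comp, Q.comp_map_right]
    simp only [Q.map_map]
    rw [Q.comp_map_shift
      (((optSumL K Jq).sumCongr (Equiv.refl (I ⊕ Jp))).trans (optSumL (K ⊕ Jq) (I ⊕ Jp)))
      (col_trans (col_sumCongr (col_optSumL (b := b')) (col_refl (c := Sum.elim c dp)))
        col_optSumL)
      (sumComm4 K Jq I Jp) col_sumComm4 (by rintro (((_ | _) | _) | (_ | _)) <;> rfl)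
      (Q.comp _ _)]
    simp only [Q.map_map]
    exact Q.map_congr (by rintro ((_ | _) | ((_ | _) | (_ | _))) <;> rfl) _
  comp_comm := by
    intro I K L _ _ _ c d f b b' c₀ p q r
    induction p using Quot.ind with | mk p
    obtain ⟨Jp, dp, p, ap⟩ := p
    induction q using Quot.ind with | mk q
    obtain ⟨Jq, dq, q, aq⟩ := q
    induction r using Quot.ind with | mk r
    obtain ⟨Jr, dr, r, ar⟩ := r
    refine env_sound (sumLeftComm Jr Jq Jp) col_sumLeftComm ?_
      (by rintro (_ | (_ | _)) <;> exact HEq.rfl)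
    dsimp only [Expr.map, Expr.comp]
    have hc := Q.comp_comm (Q.map ((optSumL (Option I) Jp).trans (optSumL I Jp).optionCongr)
      (col_trans (col_optSumL (b := b)) (col_optionCongr (col_optSumL (b := b') (c := dp)))) p) q r
    rw [Q.map_map, Q.comp_map_shift (optSumL (Option I) Jp) (col_optSumL (b := b)) (optSumL I Jp)
      (col_optSumL (b := b')) (fun _ => rfl)] at hc
    rw [Q.comp_map_shift (((optSwap I).sumCongr (Equiv.refl Jp)).trans (optSumL (Option I) Jp))
      (col_trans (col_sumCongr (col_optSwap (b := b) (b' := b')) (col_refl (c := dp)))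
        col_optSumL) (optSumL I Jp) (col_optSumL (b := b))
        (by rintro ((_ | (_ | _)) | _) <;> rfl)] at hc
    simp only [Q.map_map] at hc ⊢
    rw [Q.comp_map_shift
      (((Equiv.refl (K ⊕ Jq)).sumCongr (optSumL I Jp)).trans (optSumR (K ⊕ Jq) (I ⊕ Jp)))
      (col_trans (col_sumCongr (col_refl (c := Sum.elim d dq)) (col_optSumL (b := b')))
        col_optSumR)
      (sumComm4 K Jq I Jp) col_sumComm4 (by rintro ((_ | _) | ((_ | _) | _)) <;> rfl)
      (Q.comp _ _), hc, Q.comp_map_shift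
      (((Equiv.refl (L ⊕ Jr)).sumCongr (optSumL I Jp)).trans (optSumR (L ⊕ Jr) (I ⊕ Jp)))
      (col_trans (col_sumCongr (col_refl (c := Sum.elim f dr)) (col_optSumL (b := b)))
        col_optSumR)
      (sumComm4 L Jr I Jp) col_sumComm4 (by rintro ((_ | _) | ((_ | _) | _)) <;> rfl)
      (Q.comp _ _)]
    simp only [Q.map_map]
    exact Q.map_congr (by rintro ((_ | _) | ((_ | _) | (_ | _))) <;> rfl) _

/-- The evaluation `q(h_1, …, h_m, a_1, …, a_n) ↦ q(x_1, …, x_m, a_1, …, a_n)` at elements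
`x_i` of `A`. -/
def EnvOp.eval {I : Type} [Finite I] {c : I → C} {c₀ : C} (p : EnvOp A I c c₀)
    (x : ∀ i, A.carrier (c i)) : A.carrier c₀ :=
  Quot.lift (fun p : Expr A c c₀ => A.act p.op (sumFam x p.elts)) (by
    rintro p p' (⟨e, d, q, a⟩ | ⟨q, p, y, z⟩)
    · dsimp only
      rw [A.act_map]
      congr 1
      funext i
      rcases i with _ | _ <;> rfl
    · dsimp only
      rename_i J K _ _ d k b
      have e₁ : pullFam (sumLeftComm K I J) col_sumLeftComm (sumFam x (sumFam y z)) =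
          sumFam y (sumFam x z) := by
        funext i
        rcases i with _ | (_ | _) <;> rfl
      have e₂ : pullFam (optSumR I J).symm col_optSumR_symm (sumFam x (optFam (A.act p y) z)) =
          optFam (A.act p y) (sumFam x z) := by
        funext i
        rcases i with _ | (_ | _) <;> rfl
      rw [A.act_map, A.act_map, e₁, e₂, A.act_comp]) p

/-- `A` as an algebra over its enveloping operad, by evaluation of expressions. This is the
identity `A → A` seen as a `Q`-algebra under `A`. -/
def evalAlgebra : Algebra.{u, max 1 u v w, w} (envelopingOperad A) where
  carrier := A.carrier
  act := EnvOp.eval A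
  act_map := by
    intro I J _ _ c c' c₀ e h q x
    induction q using Quot.ind with | mk q
    obtain ⟨Jq, dq, q, aq⟩ := q
    refine (A.act_map _ _ _ _).trans ?_
    congr 1
    funext i
    rcases i with _ | _ <;> rfl
  act_one := by
    intro b x
    exact (A.act_map _ _ _ _).trans (A.act_one _ _)
  act_comp := by
    intro I K _ _ c d b c₀ p q x y
    induction p using Quot.ind with | mk p
    induction q using Quot.ind with | mk q
    obtain ⟨Jp, dp, p, ap⟩ := p
    obtain ⟨Jq, dq, q, aq⟩ := q
    have e₁ : pullFam (sumComm4 K Jq I Jp) col_sumComm4 (sumFam (sumFam x y) (sumFam aq ap)) =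
        sumFam (sumFam x aq) (sumFam y ap) := by
      funext i
      rcases i with (_ | _) | (_ | _) <;> rfl
    have e₂ : pullFam (optSumL I Jp) col_optSumL
        (optFam (A.act q (sumFam x aq)) (sumFam y ap)) =
          sumFam (optFam (A.act q (sumFam x aq)) y) ap := by
      funext i
      rcases i with (_ | _) | _ <;> rfl
    refine (A.act_map _ _ _ _).trans ?_
    rw [e₁, A.act_comp, A.act_map, e₂]
    rfl

end Enveloping

/-! ## The twisted arrow operad -/

section Plus

variable {C : Type u} {P : Operad.{u, v} C} (B : Algebra.{u, v, w} P)

theorem fst_optElim {I : Type} {c : I → Σ a, B.carrier a} {b : Σ a, B.carrier a} (o : Option I) :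
    optElim b.1 (fun i => (c i).1) (Equiv.refl _ o) = (optElim b c o).1 := by
  rcases o with _ | _ <;> rfl

theorem fst_sumElim {I K : Type} {c : I → Σ a, B.carrier a} {d : K → Σ a, B.carrier a}
    (x : K ⊕ I) :
    (Sum.elim d c (Equiv.refl _ x)).1 = Sum.elim (fun i => (d i).1) (fun i => (c i).1) x := by
  rcases x with _ | _ <;> rfl

theorem snd_pull {I J : Type} {c : I → Σ a, B.carrier a} {d : J → Σ a, B.carrier a}
    (e : I → J) (h : ∀ i, d (e i) = c i) (h' : ∀ i, (d (e i)).1 = (c i).1) :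
    pullFam (X := B.carrier) (c := fun i => (c i).1) (d := fun i => (d i).1) e h'
      (fun j => (d j).2) = fun i => (c i).2 := by
  funext i
  have := h i
  refine eq_of_heq ((cast_heq _ _).trans ?_)
  dsimp only
  rw [this]

/-- The operad of evaluated operations of an algebra `B` over an operad `P`: its colours are the
elements of `B`, and its operations of input colours `a'_i` and output colour `a'_0` are
the operations `p` of `P` such that `p(a'_1, …, a'_m) = a'_0`. -/
def Algebra.plus : Operad.{max u w, v} (Σ c, B.carrier c) where
  Op := fun I _ a a₀ =>
    {p : P.Op I (fun i => (a i).1) a₀.1 // B.act p (fun i => (a i).2) = a₀.2}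
  map := fun e h p => ⟨P.map e (fun i => congrArg Sigma.fst (h i)) p.1, by
    rw [B.act_map, snd_pull B e h, p.2]⟩
  one := fun b => ⟨P.one b.1, B.act_one b.1 _⟩
  comp := fun {I K} _ _ {c d b c₀} p q =>
    ⟨P.map (Equiv.refl _) (fst_sumElim B)
      (P.comp (P.map (Equiv.refl _) (fst_optElim B) p.1) q.1), by
      have e₁ : pullFam (Equiv.refl _) (fst_sumElim B) (fun i => (Sum.elim d c i).2) =
          sumFam (X := B.carrier) (fun i => (d i).2) (fun i => (c i).2) := by
        funext i
        rcases i with _ | _ <;> rfl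
      have e₂ : pullFam (Equiv.refl _) (fst_optElim B)
          (optFam (X := B.carrier) b.2 (fun i => (c i).2)) = fun o => (optElim b c o).2 := by
        funext i
        rcases i with _ | _ <;> rfl
      rw [B.act_map, e₁, B.act_comp, q.2, B.act_map, e₂, p.2]⟩
  map_refl := by
    intro I _ c c₀ p
    exact Subtype.ext (P.map_refl p.1)
  map_map := by
    intro I J K _ _ _ c c' c'' c₀ e h e' h' p
    exact Subtype.ext (P.map_map _ _ _ _ p.1)
  comp_map := by
    intro I I' K K' _ _ _ _ c c' d d' b c₀ e h f k p q
    refine Subtype.ext ?_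
    simp only [P.map_map]
    rw [P.comp_map_right, P.comp_map_shift
      (g' := e.optionCongr.trans (Equiv.refl _)) (Equiv.refl _) (fst_optElim B) e
      (fun i => congrArg Sigma.fst (h i)) (fun _ => rfl)]
    simp only [P.map_map]
    exact P.map_congr (by rintro (_ | _) <;> rfl) _
  comp_one := by
    intro I _ c b c₀ p
    refine Subtype.ext ?_
    simp only [P.comp_one, P.map_map]
    exact P.map_congr (by rintro (_ | _) <;> rfl) _
  one_comp := by
    intro K _ d b q
    refine Subtype.ext ?_
    simp only [P.map_map]
    rw [P.comp_map_shift unitOpt (col_unitOpt (b := b.1)) (Equiv.refl _)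
      (by rintro ⟨⟩) (fun _ => rfl), P.one_comp]
    simp only [P.map_map]
    exact P.map_congr (by intro _; rfl) _
  comp_comp := by
    intro I K L _ _ _ c d f b b' c₀ p q r
    refine Subtype.ext ?_
    simp only [P.map_map]
    rw [P.comp_map_right, P.comp_comp, P.comp_map_right]
    simp only [P.map_map]
    exact P.map_comp_congr (Equiv.refl _) (fun i => (fst_sumElim B i).trans rfl)
      (by rintro ((_ | _) | _) <;> rfl) (by rintro (_ | (_ | _)) <;> rfl) _ _
  comp_comm := by
    intro I K L _ _ _ c d f b b' c₀ p q r
    refine Subtype.ext ?_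
    have h : ∀ o, optElim b.1 (optElim b'.1 (fun i => (c i).1)) (Equiv.refl _ o) =
        (optElim b (optElim b' c) o).1 := by
      rintro (_ | (_ | _)) <;> rfl
    have hc := P.comp_comm (P.map (Equiv.refl _) h p.1) q.1 r.1
    have h₁ : ∀ o, optElim b'.1 (fun i => (c i).1) (Equiv.refl _ o) = (optElim b' c o).1 :=
      fst_optElim B
    have h₂ : ∀ o, optElim b.1 (fun i => (c i).1) (Equiv.refl _ o) = (optElim b c o).1 :=
      fst_optElim B
    rw [P.map_map, P.comp_map_shift (g' := Equiv.refl _) (Equiv.refl _) (fst_optElim B)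
      (Equiv.refl _) h₁ (by rintro (_ | _) <;> rfl),
      P.comp_map_shift (g' := (Equiv.refl _).trans (optSwap I))
        ((optSwap I).trans (Equiv.refl _)) (col_trans
          (c' := fun o => (optElim b' (optElim b c) o).1)
          (fun o => congrArg Sigma.fst (col_optSwap o)) (fst_optElim B))
        (Equiv.refl _) h₂ (by rintro (_ | (_ | _)) <;> rfl)] at hc
    simp only [P.map_map] at hc ⊢
    rw [P.comp_map_shift
      (((Equiv.refl K).sumCongr (Equiv.refl (Option I))).trans (optSumR K I))
      (col_trans (col_sumCongr (col_refl (c := fun i => (d i).1)) h₁) col_optSumR)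
      (Equiv.refl _) (fst_sumElim B) (by rintro (_ | (_ | _)) <;> rfl) (P.comp _ _) r.1, hc]
    simp only [P.map_map]
    exact P.map_comp_congr (Equiv.refl _) (fst_sumElim B)
      (by rintro (_ | (_ | _)) <;> rfl) (by rintro (_ | (_ | _)) <;> rfl) _ _

end Plus

/-! ## Rooted trees -/

/-- Planar rooted trees whose vertices are labelled by elements `v` of `V`, a vertex labelled by
`v` having `n v` ordered inputs, and whose leaves are labelled by elements of `L`.
The tree `leaf l` is the edge without vertices. -/
inductive RTree {V : Type} (n : V → ℕ) (L : Type) : Type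
  | leaf (l : L) : RTree n L
  | node (v : V) (ch : Fin (n v) → RTree n L) : RTree n L

namespace RTree

variable {V W X : Type} {n : V → ℕ} {m : W → ℕ} {k : X → ℕ} {L L' L'' : Type}

/-- Grafting of trees onto leaves. -/
def graft : RTree n L → (L → RTree n L') → RTree n L'
  | leaf l, f => f l
  | node v ch, f => node v (fun i => (ch i).graft f)

/-- Substitution of trees into the vertices: the vertex `v` is replaced by the tree `s v`, whose
`i`-th leaf is identified with the `i`-th input of `v`. -/
def subst (s : ∀ v, RTree m (Fin (n v))) : RTree n L → RTree m L
  | leaf l => leaf l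
  | node v ch => (s v).graft (fun i => (ch i).subst s)

/-- The tree with one vertex, with the planar order of leaves. -/
def corolla (v : V) : RTree n (Fin (n v)) := node v leaf

/-- The number of occurrences of a vertex label. -/
noncomputable def vcount (v : V) : RTree n L → ℕ
  | leaf _ => 0
  | node w ch => by classical exact (if w = v then 1 else 0) + ∑ i, (ch i).vcount v

/-- The number of occurrences of a leaf label. -/
noncomputable def lcount (l : L) : RTree n L → ℕ
  | leaf l' => by classical exact if l' = l then 1 else 0
  | node _ ch => ∑ i, (ch i).lcount l

/-- Every element of `V` labels exactly one vertex, and every element of `L` labels exactly one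
leaf. -/
def IsLinear (t : RTree n L) : Prop := (∀ v, t.vcount v = 1) ∧ ∀ l, t.lcount l = 1

theorem graft_leaf (t : RTree n L) : t.graft leaf = t := by
  induction t with
  | leaf l => rfl
  | node v ch ih => simp only [graft, ih]

theorem graft_graft (t : RTree n L) (f : L → RTree n L') (g : L' → RTree n L'') :
    (t.graft f).graft g = t.graft (fun l => (f l).graft g) := by
  induction t with
  | leaf l => rfl
  | node v ch ih => simp only [graft, ih]

theorem subst_graft (s : ∀ v, RTree m (Fin (n v))) (t : RTree n L) (f : L → RTree n L') :
    (t.graft f).subst s = (t.subst s).graft (fun l => (f l).subst s) := by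
  induction t with
  | leaf l => rfl
  | node v ch ih => simp only [graft, subst, ih, graft_graft]

theorem subst_subst (s : ∀ v, RTree m (Fin (n v))) (s' : ∀ w, RTree k (Fin (m w)))
    (t : RTree n L) : (t.subst s).subst s' = t.subst (fun v => (s v).subst s') := by
  induction t with
  | leaf l => rfl
  | node v ch ih => simp only [subst, subst_graft, ih]

theorem subst_corolla (s : ∀ v, RTree m (Fin (n v))) (v : V) :
    (corolla v).subst s = s v := by
  simp only [corolla, subst, graft_leaf]

theorem subst_id (t : RTree n L) : t.subst corolla = t := by
  induction t with
  | leaf l => rfl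
  | node v ch ih => simp only [subst, ih]; rfl

theorem lcount_graft [Fintype L] (l : L') (t : RTree n L) (f : L → RTree n L') :
    (t.graft f).lcount l = ∑ x, t.lcount x * (f x).lcount l := by
  induction t with
  | leaf y => classical simp [graft, lcount]
  | node v ch ih =>
    simp only [graft, lcount, ih, Finset.sum_mul]
    exact Finset.sum_comm

theorem vcount_graft [Fintype L] (v : V) (t : RTree n L) (f : L → RTree n L') :
    (t.graft f).vcount v = t.vcount v + ∑ x, t.lcount x * (f x).vcount v := by
  induction t with
  | leaf y => classical simp [graft, lcount, vcount]
  | node w ch ih =>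
    simp only [graft, lcount, vcount, ih, Finset.sum_mul, Finset.sum_add_distrib]
    rw [Finset.sum_comm, add_assoc]

theorem lcount_subst (s : ∀ v, RTree m (Fin (n v))) (hs : ∀ v i, (s v).lcount i = 1)
    (l : L) (t : RTree n L) : (t.subst s).lcount l = t.lcount l := by
  induction t with
  | leaf y => rfl
  | node v ch ih => simp only [subst, lcount_graft, lcount, ih, hs, one_mul]

theorem vcount_subst [Fintype V] (s : ∀ v, RTree m (Fin (n v)))
    (hs : ∀ v i, (s v).lcount i = 1) (w : W) (t : RTree n L) :
    (t.subst s).vcount w = ∑ v, t.vcount v * (s v).vcount w := by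
  induction t with
  | leaf y => simp [subst, vcount]
  | node v ch ih =>
    classical
    simp only [subst, vcount_graft, vcount, ih, hs, one_mul, add_mul, Finset.sum_add_distrib,
      Finset.sum_mul]
    rw [Finset.sum_comm]
    simp

theorem IsLinear.subst [Finite V] {s : ∀ v, RTree m (Fin (n v))}
    (hs : ∀ v i, (s v).lcount i = 1)
    (hw : ∀ [Fintype V] w, ∑ v, (s v).vcount w = 1) {t : RTree n L} (ht : t.IsLinear) :
    (t.subst s).IsLinear := by
  have := Fintype.ofFinite V
  refine ⟨fun w => ?_, fun l => ?_⟩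
  · rw [vcount_subst s hs]
    simp only [ht.1, one_mul]
    exact hw w
  · rw [lcount_subst s hs]
    exact ht.2 l

/-- The corolla with vertex `w`, as a tree to be substituted into a vertex with `a` inputs. -/
def corollaOf (w : W) {a : ℕ} (h : m w = a) : RTree m (Fin a) :=
  node w (fun i => leaf (Fin.cast h i))

theorem subst_corollaOf (s : ∀ v, RTree m (Fin (n v))) (v : V) :
    (corollaOf v rfl).subst s = s v := subst_corolla s v

theorem lcount_corollaOf (w : W) {a : ℕ} (h : m w = a) (i : Fin a) :
    (corollaOf w h).lcount i = 1 := by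
  subst h
  simp only [corollaOf, lcount]
  rw [Finset.sum_eq_single i (fun j _ hj => by simp [hj]) (fun hi => absurd (Finset.mem_univ i) hi)]
  simp

theorem vcount_corollaOf [DecidableEq W] (w w' : W) {a : ℕ} (h : m w = a) :
    (corollaOf w h).vcount w' = if w = w' then 1 else 0 := by
  subst h
  simp only [corollaOf, vcount, Finset.sum_const_zero, add_zero]
  congr

theorem corolla_isLinear {a : ℕ} {m : Unit → ℕ} (h : m () = a) :
    (corollaOf () h).IsLinear := by
  classical
  exact ⟨fun v => by rw [vcount_corollaOf]; simp, lcount_corollaOf _ _⟩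

/-- Relabelling of vertices. -/
def relabel (e : V → W) (h : ∀ v, m (e v) = n v) (t : RTree n L) : RTree m L :=
  t.subst (fun v => corollaOf (e v) (h v))

end RTree

/-! ## The operad encoding symmetric operads -/

namespace SOp

variable {I J K L : Type} {c : I → ℕ} {c' : J → ℕ} {d : K → ℕ} {b c₀ : ℕ}

/-- The trees that are substituted into the vertices of `p` in the composition `p ∘ q`: the tree
`q` into the vertex `none`, and corollas into the other vertices. -/
def sub (c : I → ℕ) (q : RTree d (Fin b)) :
    ∀ o : Option I, RTree (Sum.elim d c) (Fin (optElim b c o))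
  | none => q.relabel Sum.inl (fun _ => rfl)
  | some i => RTree.corollaOf (Sum.inr i) rfl

theorem lcount_relabel (e : I → J) (h : ∀ i, c' (e i) = c i) (t : RTree c L) (l : L) :
    (t.relabel e h).lcount l = t.lcount l :=
  RTree.lcount_subst _ (fun _ _ => RTree.lcount_corollaOf _ _ _) _ _

theorem vcount_relabel [Fintype I] [DecidableEq J] (e : I → J) (h : ∀ i, c' (e i) = c i)
    (t : RTree c L) (j : J) :
    (t.relabel e h).vcount j = ∑ i, t.vcount i * (if e i = j then 1 else 0) := by
  rw [RTree.relabel, RTree.vcount_subst _ (fun _ _ => RTree.lcount_corollaOf _ _ _)]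
  simp only [RTree.vcount_corollaOf]

theorem isLinear_relabel [Finite I] (e : I ≃ J) (h : ∀ i, c' (e i) = c i) {t : RTree c L}
    (ht : t.IsLinear) : (t.relabel e h).IsLinear := by
  classical
  refine RTree.IsLinear.subst (fun _ _ => RTree.lcount_corollaOf _ _ _) ?_ ht
  intro _ j
  simp only [RTree.vcount_corollaOf]
  rw [Finset.sum_eq_single (e.symm j)]
  · simp
  · intro i _ hi
    rw [if_neg]
    rintro rfl
    simp at hi
  · simp

theorem vcount_sub_none [Finite K] (c : I → ℕ) {q : RTree d (Fin b)} (hq : q.IsLinear)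
    (w : K ⊕ I) : (sub c q none).vcount w = Sum.elim (fun _ => 1) (fun _ => 0) w := by
  classical
  have := Fintype.ofFinite K
  refine (vcount_relabel _ _ _ _).trans ?_
  refine (Finset.sum_congr rfl fun i _ =>
    congrArg (· * (if (Sum.inl i : K ⊕ I) = w then 1 else 0)) (hq.1 i)).trans ?_
  rcases w with k | i <;> simp

theorem vcount_sub_some [DecidableEq (K ⊕ I)] (q : RTree d (Fin b)) (i : I) (w : K ⊕ I) :
    (sub c q (some i)).vcount w = if Sum.inr i = w then 1 else 0 :=
  RTree.vcount_corollaOf _ _ _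

theorem isLinear_comp [Finite I] [Finite K] {p : RTree (optElim b c) L} (hp : p.IsLinear)
    {q : RTree d (Fin b)} (hq : q.IsLinear) : (p.subst (sub c q)).IsLinear := by
  classical
  have := Fintype.ofFinite I
  have := Fintype.ofFinite K
  refine RTree.IsLinear.subst ?_ ?_ hp
  · rintro (_ | i) l
    · exact (lcount_relabel _ _ _ _).trans (hq.2 l)
    · exact RTree.lcount_corollaOf _ _ _
  · intro inst w
    obtain rfl : inst = instFintypeOption := Subsingleton.elim _ _
    rw [Fintype.sum_option, vcount_sub_none c hq]
    simp only [vcount_sub_some]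
    rcases w with k | i <;> simp

end SOp

/-- The `ℕ`-coloured operad `sOp` whose algebras are the symmetric operads. An operation with
input colours `n_i`, `i ∈ I`, and output colour `m` is a planar rooted tree with vertices indexed
by `I`, such that the `i`-th vertex has `n_i` inputs, and with an arbitrary order on its `m`
(non-root) leaves. The composition `p ∘ q` is the substitution of the tree `q` into a vertex of
`p`. The edge without vertices is an operation with no inputs. -/
def sOp : Operad.{0, 0} ℕ where
  Op := fun I _ c m => {t : RTree c (Fin m) // t.IsLinear}
  map := fun e h t => ⟨t.1.relabel e h, SOp.isLinear_relabel e h t.2⟩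
  one := fun n => ⟨RTree.corollaOf () rfl, RTree.corolla_isLinear rfl⟩
  comp := fun {_ _} _ _ {c} _ _ _ p q => ⟨p.1.subst (SOp.sub c q.1), SOp.isLinear_comp p.2 q.2⟩
  map_refl := by
    intro I _ c m t
    exact Subtype.ext (RTree.subst_id t.1)
  map_map := by
    intro I J K _ _ _ c c' c'' m e h e' h' t
    obtain rfl : c' = fun j => c'' (e' j) := funext fun j => (h' j).symm
    obtain rfl : c = fun i => c'' (e' (e i)) := funext fun i => (h i).symm
    refine Subtype.ext ((RTree.subst_subst _ _ _).trans ?_)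
    refine congrArg (fun s => RTree.subst s t.1) (funext fun i => ?_)
    exact RTree.subst_corollaOf _ _
  comp_map := by
    intro I I' K K' _ _ _ _ c c' d d' b m e h f k p q
    obtain rfl : c = fun i => c' (e i) := funext fun i => (h i).symm
    obtain rfl : d = fun i => d' (f i) := funext fun i => (k i).symm
    refine Subtype.ext ((RTree.subst_subst _ _ _).trans (Eq.trans ?_
      (RTree.subst_subst _ _ _).symm))
    refine congrArg (fun s => RTree.subst s p.1) (funext fun i => ?_)
    rcases i with _ | i
    · refine (RTree.subst_corollaOf _ _).trans ?_
      refine (RTree.subst_subst _ _ _).trans (Eq.trans ?_ (RTree.subst_subst _ _ _).symm)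
      refine congrArg (fun s => RTree.subst s q.1) (funext fun i => ?_)
      exact (RTree.subst_corollaOf _ _).trans (RTree.subst_corollaOf _ _).symm
    · exact (RTree.subst_corollaOf _ _).trans (RTree.subst_corollaOf _ _).symm
  comp_one := by
    intro I _ c b m p
    refine Subtype.ext ?_
    refine congrArg (fun s => RTree.subst s p.1) (funext fun i => ?_)
    rcases i with _ | i
    · exact RTree.subst_corollaOf _ _
    · rfl
  one_comp := by
    intro K _ d b q
    refine Subtype.ext ((RTree.subst_subst _ _ _).trans ?_)
    refine (RTree.subst_corollaOf _ _).trans ?_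
    exact RTree.subst_corollaOf _ _
  comp_comp := by
    intro I K L _ _ _ c d f b b' m p q r
    refine Subtype.ext ?_
    refine Eq.trans ?_ ((congrArg (fun t => RTree.relabel _ _ (RTree.subst _ t))
      (RTree.subst_subst _ _ _)).trans ((congrArg (RTree.relabel _ _)
      (RTree.subst_subst _ _ _)).trans (RTree.subst_subst _ _ _))).symm
    refine congrArg (fun s => RTree.subst s p.1) (funext fun i => ?_)
    rcases i with _ | i
    · refine (RTree.subst_subst _ _ _).trans (Eq.trans ?_
        ((congrArg (fun t => RTree.subst _ (RTree.subst _ t)) (RTree.subst_subst _ _ _)).trans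
          ((congrArg (RTree.subst _) (RTree.subst_subst _ _ _)).trans
            (RTree.subst_subst _ _ _))).symm)
      refine congrArg (fun s => RTree.subst s q.1) (funext fun i => ?_)
      rcases i with _ | i
      · refine (RTree.subst_subst _ _ _).trans (Eq.trans ?_
          ((congrArg (RTree.subst _)
            (RTree.subst_corollaOf (SOp.sub (Sum.elim d c) r.1) none)).trans
            (RTree.subst_subst _ _ _)).symm)
        exact congrArg (fun s => RTree.subst s r.1) (funext fun i => rfl)
      · rfl
    · rfl
  comp_comm := by
    intro I K L _ _ _ c d f b b' m p q r
    refine Subtype.ext ?_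
    refine Eq.trans ((congrArg (RTree.subst _) (RTree.subst_subst _ _ _)).trans
      (RTree.subst_subst _ _ _)) (Eq.trans ?_
        ((congrArg (fun t => RTree.subst _ (RTree.subst _ (RTree.subst _ t)))
          (RTree.subst_subst _ _ _)).trans
        ((congrArg (fun t => RTree.subst _ (RTree.subst _ t)) (RTree.subst_subst _ _ _)).trans
          ((congrArg (RTree.subst _) (RTree.subst_subst _ _ _)).trans
            (RTree.subst_subst _ _ _)))).symm)
    refine congrArg (fun s => RTree.subst s p.1) (funext fun i => ?_)
    rcases i with _ | (_ | i)
    · refine Eq.trans ((congrArg (RTree.subst _) (RTree.subst_subst _ _ _)).trans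
        (RTree.subst_subst _ _ _)) (Eq.trans ?_
          ((congrArg (RTree.subst _)
            (RTree.subst_corollaOf (SOp.sub (Sum.elim f c) q.1) none)).trans
            (RTree.subst_subst _ _ _)).symm)
      exact congrArg (fun s => RTree.subst s q.1) (funext fun i => rfl)
    · refine Eq.trans (RTree.subst_corollaOf (SOp.sub (Sum.elim d c) r.1) none) (Eq.trans ?_
        ((congrArg (fun t => RTree.subst _ (RTree.subst _ (RTree.subst _ t)))
          (RTree.subst_corollaOf (SOp.sub (optElim b c) r.1) none)).trans
        ((congrArg (fun t => RTree.subst _ (RTree.subst _ t)) (RTree.subst_subst _ _ _)).trans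
          ((congrArg (RTree.subst _) (RTree.subst_subst _ _ _)).trans
            (RTree.subst_subst _ _ _)))).symm)
      exact congrArg (fun s => RTree.subst s r.1) (funext fun i => rfl)
    · rfl

/-- The terminal symmetric operad `uCom`, with exactly one operation in each arity, as an algebra
over `sOp`. -/
def uCom : Algebra.{0, 0, 0} sOp where
  carrier := fun _ => Unit
  act := fun _ _ => ()
  act_map := fun _ _ _ _ => rfl
  act_one := fun _ _ => rfl
  act_comp := fun _ _ _ _ => rfl

/-! ## Twisted arrow categories and enveloping categories -/

section Categories

variable {C : Type u} {Q : Operad.{u, v} C} (A : Algebra.{u, v, w} Q)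

/-- The twisted arrow operad `TwOp_Q(A)` of a `Q`-algebra `A`: its colours are the elements of
`A`, and its operations of input colours `a'_1, …, a'_m` and output colour `a'_0` are the
classes `[q(a'_1, …, a'_m, a_1, …, a_n)]` of expressions in variables `a'_i` and elements `a_j` of
`A` such that the evaluation `q(a'_1, …, a'_m, a_1, …, a_n)` in `A` is equal to `a'_0`. -/
abbrev twistedArrowOperad : Operad.{max u w, max 1 u v w} (Σ c, A.carrier c) :=
  (evalAlgebra A).plus

/-- The twisted arrow category `Tw_Q(A)`, the category of arity one operations of the twisted
arrow operad. -/
abbrev TwistedArrowCategory : Type (max u w) := (twistedArrowOperad A).Underlying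

/-- The enveloping category `U_Q(A)`, the category of arity one operations of the enveloping
operad. -/
abbrev EnvelopingCategory : Type u := (envelopingOperad A).Underlying

end Categories

/-! ## Segal's category -/

/-- The category of finite pointed sets. -/
abbrev FinPointed : Type 1 := ObjectProperty.FullSubcategory fun X : Pointed.{0} => Finite X

/-- Segal's category `Γ`, the standard skeleton of the opposite of the category of finite
pointed sets: its objects are the sets `[n] = {0, …, n}` pointed at `0`, and the morphisms
from `[n]` to `[m]` are the pointed maps from `[m]` to `[n]`. -/
structure Gamma : Type where
  n : ℕ

instance : Category.{0} Gamma where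
  Hom a b := {f : Fin (b.n + 1) → Fin (a.n + 1) // f 0 = 0}
  id a := ⟨id, rfl⟩
  comp f g := ⟨f.1 ∘ g.1, by rw [Function.comp_apply, g.2, f.2]⟩

/-- The inclusion of `Γ` into the opposite of the category of finite pointed sets. -/
def Gamma.incl : Gamma ⥤ FinPointedᵒᵖ where
  obj a := .op ⟨Pointed.of (0 : Fin (a.n + 1)), inferInstanceAs (Finite (Fin (a.n + 1)))⟩
  map f := Quiver.Hom.op ⟨⟨f.1, f.2⟩⟩

theorem Gamma.isSkeletonOf : IsSkeletonOf FinPointedᵒᵖ Gamma Gamma.incl where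
  skel := by
    rintro ⟨a⟩ ⟨b⟩ ⟨i⟩
    have h₁ : ∀ x, i.hom.1 (i.inv.1 x) = x := fun x =>
      congrFun (congrArg Subtype.val i.hom_inv_id) x
    have h₂ : ∀ x, i.inv.1 (i.hom.1 x) = x := fun x =>
      congrFun (congrArg Subtype.val i.inv_hom_id) x
    have := Fin.equiv_iff_eq.1 ⟨(⟨i.inv.1, i.hom.1, h₁, h₂⟩ : Fin (a + 1) ≃ Fin (b + 1))⟩
    obtain rfl : a = b := Nat.succ_injective this
    rfl
  eqv :=
    { faithful := ⟨fun {a b f g} h => by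
        have h' := congrArg (fun k => k.unop.hom.toFun) h
        exact Subtype.ext h'⟩
      full := ⟨fun {a b} g => ⟨⟨g.unop.hom.toFun, g.unop.hom.map_point⟩, rfl⟩⟩
      essSurj := ⟨fun X => by
        obtain ⟨⟨⟨X, x⟩, hX⟩⟩ := X
        have : Finite X := hX
        have := Fintype.ofFinite X
        classical
        obtain ⟨n, hn⟩ : ∃ n, Fintype.card X = n + 1 :=
          Nat.exists_eq_succ_of_ne_zero (Fintype.card_pos_iff.2 ⟨x⟩).ne'
        let e₀ : X ≃ Fin (n + 1) := Fintype.equivFinOfCardEq hn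
        let e : X ≃ Fin (n + 1) := e₀.trans (Equiv.swap (e₀ x) 0)
        have he : e x = 0 := Equiv.swap_apply_left _ _
        refine ⟨⟨n⟩, ⟨Iso.op ((ObjectProperty.isoMk _ (Pointed.Iso.mk e he)))⟩⟩⟩ }

/-- Two categories are isomorphic if there are mutually inverse functors between them. -/
def AreIsomorphic (C : Type u) [Category.{v} C] (D : Type*) [Category* D] : Prop :=
  ∃ (F : C ⥤ D) (G : D ⥤ C), F ⋙ G = 𝟭 C ∧ G ⋙ F = 𝟭 D

end TwArr

/-! A morphism `n → m` of the enveloping category of `uCom` is the class of a tree with `m` labelled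
leaves, one distinguished vertex of arity `n` (the variable), and further vertices, each carrying
the only element of `uCom` of its arity. The relations forget the names of the further vertices and
contract any subtree made of them to a single vertex. The subtree may be a bare edge, so unary
vertices can be inserted or deleted, and its leaves may be in any order, so the planar order at
these vertices is lost. What survives is, for every leaf, the input of the distinguished vertex that
it lies above, if there is one. This is a map `Fin m → Option (Fin n)`, that is, a pointed map `[m]
→ [n]`, that is, a morphism `[n] → [m]` of `Γ`.

The map is well defined because it is read off from the path weights `wsum`, which are additive
under grafting and pulled back under substitution; a substituted tree without the variable
contributes weight zero (`Expr.above_eq_of_rel`). The same computation turns composition into the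
product of 0/1 matrices, that is, into composition of partial maps (`EnvOp.leafMap_comp`).

The map is a complete invariant. Cut a tree at the distinguished vertex, contract everything that is
not above it to one root vertex, and contract the part above each input to one vertex. The resulting
normal form depends only on the map `f` (`reflTransGen_normalForm`), and it exists for every `f`.
This gives injectivity and surjectivity of `EnvOp.leafMap`.

The contractions are carried out on trees in which a vertex other than the variable is labelled only
by its arity (its "shape"). A shape lifts to a tree with pairwise distinct vertex labels, uniquely
up to bijection (`exists_lift`). Hence equal shapes give equal classes (`Expr.mk_eq_of_shape_eq`),
and a contraction of shapes comes from a defining relation (`Expr.mk_eq_of_contractsTo`).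

For the twisted arrow category, the condition on the evaluation is vacuous because every set
`uCom(n)` is a point. The functor to the enveloping category is therefore fully faithful, and it is
bijective on objects. -/

namespace TwArr

namespace RTree

/-! ### Counting labels and weighing paths in trees. -/

section General

variable {V W X : Type} {n : V → ℕ} {m : W → ℕ} {k : X → ℕ} {L L' : Type}

theorem relabel_node (e : V → W) (h : ∀ v, m (e v) = n v) (v : V)
    (ch : Fin (n v) → RTree n L) :
    (node v ch).relabel e h = node (e v) fun i => (ch (Fin.cast (h v) i)).relabel e h := rfl

theorem relabel_graft (e : V → W) (h : ∀ v, m (e v) = n v) (t : RTree n L)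
    (f : L → RTree n L') :
    (t.graft f).relabel e h = (t.relabel e h).graft fun l => (f l).relabel e h :=
  subst_graft _ _ _

theorem relabel_relabel (e : V → W) (h : ∀ v, m (e v) = n v) (e' : W → X)
    (h' : ∀ w, k (e' w) = m w) (t : RTree n L) :
    (t.relabel e h).relabel e' h' =
      t.relabel (fun v => e' (e v)) (fun v => (h' (e v)).trans (h v)) := by
  induction t with
  | leaf l => rfl
  | node v ch ih =>
    simp only [relabel_node, ih]
    rfl

theorem relabel_congr {e e' : V → W} {h : ∀ v, m (e v) = n v} {h' : ∀ v, m (e' v) = n v}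
    (he : ∀ v, e v = e' v) (t : RTree n L) : t.relabel e h = t.relabel e' h' := by
  obtain rfl : e = e' := funext he
  rfl

theorem vcount_node [DecidableEq V] (v w : V) (ch : Fin (n w) → RTree n L) :
    (node w ch).vcount v = (if w = v then 1 else 0) + ∑ i, (ch i).vcount v := by
  simp only [vcount]
  congr

theorem lcount_leaf [DecidableEq L] (l l' : L) :
    (leaf l' : RTree n L).lcount l = if l' = l then 1 else 0 := by
  simp only [lcount]
  congr

theorem lcount_relabel (e : V → W) (h : ∀ v, m (e v) = n v) (t : RTree n L) (l : L) :
    (t.relabel e h).lcount l = t.lcount l :=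
  lcount_subst _ (fun _ _ => lcount_corollaOf _ _ _) _ _

/-- Every occurrence of `v` produces one `w`, and no child is dropped or duplicated because each
leaf of each `s x` occurs once. Unlike `vcount_subst`, this needs no finiteness of `V`, so it
applies to the infinite label type `A ⊕ ℕ` of shapes. -/
theorem vcount_subst_of_unique [DecidableEq V] {s : ∀ v, RTree m (Fin (n v))}
    (hs : ∀ v i, (s v).lcount i = 1) {w : W} {v : V}
    (hw : ∀ x, (s x).vcount w = if x = v then 1 else 0) (t : RTree n L) :
    (t.subst s).vcount w = t.vcount v := by
  induction t with
  | leaf _ => rfl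
  | node x ch ih => simp only [subst, vcount_graft, ih, hs, hw, one_mul, vcount_node]

theorem vcount_subst_eq_zero {s : ∀ v, RTree m (Fin (n v))} {w : W}
    (hw : ∀ x, (s x).vcount w = 0) (t : RTree n L) : (t.subst s).vcount w = 0 := by
  induction t with
  | leaf _ => rfl
  | node x ch ih => simp only [subst, vcount_graft, ih, hw, mul_zero, Finset.sum_const_zero, add_zero]

theorem vcount_relabel_of_injective {e : V → W} (he : Function.Injective e)
    (h : ∀ v, m (e v) = n v) (t : RTree n L) (v : V) :
    (t.relabel e h).vcount (e v) = t.vcount v := by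
  classical
  refine vcount_subst_of_unique (fun _ _ => lcount_corollaOf _ _ _) (fun x => ?_) t
  simp only [vcount_corollaOf, he.eq_iff]

theorem vcount_relabel_of_ne {e : V → W} {w : W} (he : ∀ v, e v ≠ w)
    (h : ∀ v, m (e v) = n v) (t : RTree n L) : (t.relabel e h).vcount w = 0 := by
  classical
  refine vcount_subst_eq_zero (fun x => ?_) t
  rw [vcount_corollaOf, if_neg (he x)]

theorem vcount_relabel_eq_card [Fintype V] [DecidableEq W] (e : V → W)
    (h : ∀ v, m (e v) = n v) {t : RTree n L} (ht : ∀ v, t.vcount v = 1) (w : W) :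
    (t.relabel e h).vcount w = (Finset.univ.filter fun v => e v = w).card := by
  rw [relabel, vcount_subst _ fun _ _ => lcount_corollaOf _ _ _]
  simp only [vcount_corollaOf, ht, one_mul, Finset.card_filter]

/-- The sum, over the occurrences of the leaf label `l`, of the weights `ω v j` of the inputs of
vertices that lie on the path from the root to the leaf. -/
noncomputable def wsum (ω : ∀ v, Fin (n v) → ℕ) (l : L) : RTree n L → ℕ
  | leaf _ => 0
  | node v ch => ∑ j, (ω v j * (ch j).lcount l + (ch j).wsum ω l)

/-- A path from the root to `l` in the grafted tree is a path in `t` to a leaf `x` followed by a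
path in `f x` to `l`; the weights of the two pieces add up. -/
theorem wsum_graft [Fintype L] (ω : ∀ v, Fin (n v) → ℕ) (l : L') (t : RTree n L)
    (f : L → RTree n L') :
    (t.graft f).wsum ω l =
      ∑ x, (t.wsum ω x * (f x).lcount l + t.lcount x * (f x).wsum ω l) := by
  induction t with
  | leaf y => classical simp [graft, wsum, lcount]
  | node v ch ih =>
    simp only [graft, wsum, lcount, ih, lcount_graft, Finset.sum_mul, Finset.mul_sum,
      ← Finset.sum_add_distrib]
    rw [Finset.sum_comm]
    refine Finset.sum_congr rfl fun x _ => Finset.sum_congr rfl fun j _ => ?_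
    ring

/-- A path that leaves `v` through its input `j` is replaced by the path of `s v` to the leaf `j`,
so the weight of this input becomes the weight of that path. -/
theorem wsum_subst (ω : ∀ w, Fin (m w) → ℕ) {s : ∀ v, RTree m (Fin (n v))}
    (hs : ∀ v i, (s v).lcount i = 1) (l : L) (t : RTree n L) :
    (t.subst s).wsum ω l = t.wsum (fun v j => (s v).wsum ω j) l := by
  induction t with
  | leaf y => rfl
  | node v ch ih => simp only [subst, wsum, wsum_graft, ih, hs, one_mul, lcount_subst s hs]

theorem wsum_corollaOf (ω : ∀ w, Fin (m w) → ℕ) (w : W) {a : ℕ} (h : m w = a) (i : Fin a) :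
    (corollaOf w h).wsum ω i = ω w (Fin.cast h.symm i) := by
  classical
  subst h
  simp [corollaOf, wsum, lcount_leaf]

theorem wsum_relabel (ω : ∀ w, Fin (m w) → ℕ) (e : V → W) (h : ∀ v, m (e v) = n v) (l : L)
    (t : RTree n L) :
    (t.relabel e h).wsum ω l = t.wsum (fun v j => ω (e v) (Fin.cast (h v).symm j)) l := by
  rw [relabel, wsum_subst _ fun _ _ => lcount_corollaOf _ _ _]
  simp only [wsum_corollaOf]

theorem wsum_eq_zero {ω : ∀ v, Fin (n v) → ℕ} (hω : ∀ v j, ω v j = 0) (l : L)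
    (t : RTree n L) : t.wsum ω l = 0 := by
  induction t with
  | leaf y => rfl
  | node v ch ih => simp only [wsum, ih, hω, zero_mul, add_zero, Finset.sum_const_zero]

theorem sum_wsum {ι : Type} [Fintype ι] (ω : ι → ∀ v, Fin (n v) → ℕ) (l : L)
    (t : RTree n L) : ∑ i, t.wsum (ω i) l = t.wsum (fun v j => ∑ i, ω i v j) l := by
  induction t with
  | leaf y => simp [wsum]
  | node v ch ih =>
    simp only [wsum, ← ih, Finset.sum_mul, ← Finset.sum_add_distrib]
    exact Finset.sum_comm

/-- A path leaves each vertex through one input only, so an occurrence of `l` collects at most one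
unit from each occurrence of `v`. -/
theorem wsum_le [DecidableEq V] {ω : ∀ v, Fin (n v) → ℕ} {v : V}
    (hω : ∀ w j, ω w j ≤ if w = v then 1 else 0) (l : L) (t : RTree n L) :
    t.wsum ω l ≤ t.vcount v * t.lcount l := by
  induction t with
  | leaf y => simp [wsum]
  | node w ch ih =>
    simp only [wsum, vcount_node, lcount, add_mul, Finset.sum_add_distrib, Finset.mul_sum]
    refine add_le_add (Finset.sum_le_sum fun j _ => Nat.mul_le_mul_right _ (hω w j))
      (Finset.sum_le_sum fun j _ => (ih j).trans (Nat.mul_le_mul_right _ ?_))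
    exact Finset.single_le_sum (f := fun i => (ch i).vcount v) (fun _ _ => Nat.zero_le _)
      (Finset.mem_univ j)

/-! ### Lifting a tree to one with pairwise distinct vertex labels. -/

/-- Every tree is a relabelling of a tree whose vertex labels are pairwise distinct, and this
tree is initial among the trees with the given relabelling. -/
theorem exists_lift (t : RTree n L) :
    ∃ (P : Type) (_ : Fintype P) (lab : P → V) (T : RTree (fun p => n (lab p)) L),
      (∀ p, T.vcount p = 1) ∧ T.relabel lab (fun _ => rfl) = t ∧
      ∀ (J : Type) (c : J → ℕ) (lam : J → V) (h : ∀ j, n (lam j) = c j) (t' : RTree c L),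
        t'.relabel lam h = t → ∃ (φ : P → J) (hφ : ∀ p, lam (φ p) = lab p),
          t' = T.relabel φ (fun p => (h (φ p)).symm.trans (congrArg n (hφ p))) := by
  classical
  induction t with
  | leaf l =>
    refine ⟨Empty, inferInstance, Empty.elim, leaf l, fun p => p.elim, rfl, ?_⟩
    intro J c lam h t' ht'
    refine ⟨Empty.elim, fun p => p.elim, ?_⟩
    cases t' with
    | leaf l' =>
      cases ht'
      rfl
    | node j ch => cases ht'
  | node v ch ih =>
    choose P fP lab T h₁ h₂ h₃ using ih
    -- The new labels are the vertices themselves: `none` is the root, and `some ⟨i, p⟩` is the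
    -- vertex `p` of the `i`-th child.
    refine ⟨Option (Σ i, P i), inferInstance, fun o => o.elim v fun x => lab x.1 x.2,
      node none fun i => (T i).relabel (fun p => some ⟨i, p⟩) fun _ => rfl, ?_, ?_, ?_⟩
    · rintro (_ | ⟨i, p⟩)
      · refine (vcount_node _ _ _).trans (congrArg₂ (· + ·) (if_pos rfl)
          (Finset.sum_eq_zero fun i _ => ?_))
        exact vcount_relabel_of_ne (fun _ => Option.some_ne_none _) _ _
      · refine (vcount_node _ _ _).trans (congrArg₂ (· + ·) (y' := 1) (if_neg nofun) ?_)
        refine (Finset.sum_eq_single i (fun j _ hj => ?_)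
          fun hi => absurd (Finset.mem_univ i) hi).trans ?_
        · refine vcount_relabel_of_ne (fun q hq => hj ?_) _ _
          simp only [Option.some.injEq, Sigma.mk.injEq] at hq
          exact hq.1
        · refine (vcount_relabel_of_injective
            (e := fun p => some (⟨i, p⟩ : Σ i, P i)) (fun p q hpq => ?_) _ _ p).trans (h₁ i p)
          simpa using hpq
    · rw [relabel_node]
      exact congrArg (node v) (funext fun i => (relabel_relabel _ _ _ _ _).trans (h₂ i))
    · intro J c lam h t' ht'
      -- With the arities of `t'` taken from `n`, the equation between two nodes can be destructured
      -- to identify the root labels and the children.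
      obtain rfl : c = fun j => n (lam j) := funext fun j => (h j).symm
      cases t' with
      | leaf l' => cases ht'
      | node j ch' =>
        rw [relabel_node] at ht'
        cases ht'
        choose φ hφ hT using fun i => h₃ i J _ lam h (ch' i) rfl
        refine ⟨fun o => o.elim j fun x => φ x.1 x.2, ?_, ?_⟩
        · rintro (_ | ⟨i, p⟩)
          exacts [rfl, hφ i p]
        · rw [relabel_node]
          refine congrArg (node j) (funext fun i => ?_)
          exact (hT i).trans (relabel_relabel
            (m := fun o : Option (Σ i, P i) => n (o.elim (lam j) fun x => lab x.1 x.2))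
            (k := fun j => n (lam j)) (fun p => some (⟨i, p⟩ : Σ i, P i)) (fun _ => rfl)
            (fun o : Option (Σ i, P i) => o.elim j fun x => φ x.1 x.2) _ (T i)).symm

/-- If the labels of `t` are distinct, the occurrences of `w` after relabelling are counted by the
fibre of `e` over `w`. -/
theorem existsUnique_of_vcount_eq_one [Fintype V] {e : V → W} {h : ∀ v, m (e v) = n v}
    {t : RTree n L} (ht : ∀ v, t.vcount v = 1) {w : W} (hw : (t.relabel e h).vcount w = 1) :
    ∃! v, e v = w := by
  classical
  rw [vcount_relabel_eq_card e h ht, Finset.card_eq_one] at hw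
  obtain ⟨v, hv⟩ := hw
  have key : ∀ x, e x = w ↔ x = v := fun x => by
    have := Finset.ext_iff.1 hv x
    simpa using this
  exact ⟨v, (key v).2 rfl, fun x hx => (key x).1 hx⟩

section Shape

variable {A J J' : Type} {a : A → ℕ} {d : J → ℕ} {d' : J' → ℕ}

/-- The arity function on vertex labels that are either elements of `A` or natural numbers. -/
abbrev shapeArity (a : A → ℕ) : A ⊕ ℕ → ℕ := Sum.elim a id

theorem shapeArity_map (x : A ⊕ J) : shapeArity a (Sum.map id d x) = Sum.elim a d x := by
  rcases x with _ | _ <;> rfl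

/-- Replace the vertex labels in `J` by the arities of the vertices. -/
abbrev shape (t : RTree (Sum.elim a d) L) : RTree (shapeArity a) L :=
  t.relabel (Sum.map id d) shapeArity_map

theorem vcount_shape_inl (t : RTree (Sum.elim a d) L) (x : A) :
    t.shape.vcount (.inl x) = t.vcount (.inl x) := by
  classical
  refine vcount_subst_of_unique (fun _ _ => lcount_corollaOf _ _ _) (fun y => ?_) t
  rw [vcount_corollaOf]
  rcases y with y | y <;> simp

/-- Every tree in which each label in `A` occurs once is the shape of a tree in which each label
occurs once. -/
theorem exists_shape_eq (t : RTree (shapeArity a) L) (ht : ∀ x, t.vcount (.inl x) = 1) :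
    ∃ (J : Type) (_ : Finite J) (d : J → ℕ) (T : RTree (Sum.elim a d) L),
      (∀ v, T.vcount v = 1) ∧ T.shape = t := by
  obtain ⟨P, _, lab, T, hT, rfl, -⟩ := exists_lift t
  -- `g x` is the only vertex of the lift with label `x`. The remaining vertices are labelled by
  -- arities and form `J`, so `ψ` below identifies `A ⊕ J` with the set of all vertices.
  choose g hg hg' using fun x => existsUnique_of_vcount_eq_one hT (ht x)
  let J := {p : P // (lab p).isRight}
  let d : J → ℕ := fun p => (lab p.1).getRight p.2
  have hd : ∀ j : J, lab j.1 = .inr (d j) := fun j => (Sum.inr_getRight _ j.2).symm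
  let ψ : A ⊕ J → P := Sum.elim g Subtype.val
  have hψ : ∀ y, lab (ψ y) = Sum.map id d y := by
    rintro (x | j)
    exacts [hg x, hd j]
  have hb : Function.Bijective ψ := by
    constructor
    · rintro (x | j) (x' | j') hx
      · have := congrArg lab hx
        rw [hψ, hψ] at this
        exact congrArg Sum.inl (Sum.inl.inj this)
      · have := congrArg lab hx
        rw [hψ, hψ] at this
        cases this
      · have := congrArg lab hx
        rw [hψ, hψ] at this
        cases this
      · exact congrArg _ (Subtype.ext hx)
    · intro p
      rcases hp : lab p with x | k
      · exact ⟨.inl x, (hg' x p hp).symm⟩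
      · exact ⟨.inr ⟨p, by rw [hp]; rfl⟩, rfl⟩
  let ε := Equiv.ofBijective ψ hb
  have hε : ∀ p, Sum.map id d (ε.symm p) = lab p := fun p => by
    rw [← hψ]
    exact congrArg lab (ε.apply_symm_apply p)
  have hε' : ∀ p, Sum.elim a d (ε.symm p) = shapeArity a (lab p) := fun p => by
    rw [← hε, shapeArity_map]
  refine ⟨J, inferInstance, d, T.relabel ε.symm hε', fun v => ?_, ?_⟩
  · obtain ⟨p, rfl⟩ := ε.symm.surjective v
    rw [vcount_relabel_of_injective ε.symm.injective, hT]
  · rw [shape, relabel_relabel]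
    exact relabel_congr hε T

/-- A tree in which each label occurs once is determined by its shape up to relabelling. -/
theorem exists_relabel_eq {t : RTree (Sum.elim a d) L} {t' : RTree (Sum.elim a d') L}
    (ht : ∀ v, t.vcount v = 1) (ht' : ∀ v, t'.vcount v = 1) (h : t.shape = t'.shape) :
    ∃ (e : J ≃ J') (he : ∀ j, d' (e j) = d j),
      t.relabel (Equiv.sumCongr (Equiv.refl A) e) (col_sumCongr col_refl he) = t' := by
  obtain ⟨P, _, lab, T, hT, -, hu⟩ := exists_lift t.shape
  obtain ⟨φ, hφ, rfl⟩ := hu _ _ _ _ t rfl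
  obtain ⟨φ', hφ', rfl⟩ := hu _ _ _ _ t' h.symm
  have hb : Function.Bijective φ :=
    Function.bijective_iff_existsUnique φ |>.2 fun v => existsUnique_of_vcount_eq_one hT (ht v)
  have hb' : Function.Bijective φ' :=
    Function.bijective_iff_existsUnique φ' |>.2 fun v => existsUnique_of_vcount_eq_one hT (ht' v)
  -- Both trees are relabellings of the same lift along bijections. The comparison `E` preserves the
  -- labels of the shape, so it fixes `A` and restricts to an arity-preserving bijection of `J` with
  -- `J'`.
  let E : A ⊕ J ≃ A ⊕ J' := (Equiv.ofBijective φ hb).symm.trans (Equiv.ofBijective φ' hb')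
  have hEφ : ∀ p, E (φ p) = φ' p := fun p => by
    change φ' ((Equiv.ofBijective φ hb).symm (Equiv.ofBijective φ hb p)) = _
    rw [Equiv.symm_apply_apply]
  have hE : ∀ y, Sum.map id d' (E y) = Sum.map id d y := fun y => by
    obtain ⟨p, rfl⟩ := hb.2 y
    rw [hEφ, hφ, hφ']
  have hl : ∀ x, E (.inl x) = .inl x := fun x => by
    have := hE (.inl x)
    rcases hy : E (.inl x) with y | j <;> rw [hy] at this <;> cases this
    rfl
  have hr : ∀ j, ∃ j', E (.inr j) = .inr j' ∧ d' j' = d j := fun j => by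
    have := hE (.inr j)
    rcases hy : E (.inr j) with y | j' <;> rw [hy] at this
    · cases this
    · exact ⟨j', rfl, Sum.inr.inj this⟩
  choose f hf hfd using hr
  have hfb : Function.Bijective f := by
    constructor
    · intro i j hij
      refine Sum.inr.inj (E.injective ?_)
      rw [hf, hf, hij]
    · intro j'
      obtain ⟨x | j, hx⟩ := E.surjective (.inr j')
      · rw [hl] at hx
        cases hx
      · exact ⟨j, Sum.inr.inj ((hf j).symm.trans hx)⟩
  refine ⟨Equiv.ofBijective f hfb, hfd, ?_⟩
  rw [relabel_relabel]
  refine relabel_congr (fun p => ?_) T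
  rw [← hEφ]
  rcases φ p with x | j
  exacts [(hl x).symm, (hf j).symm]

end Shape

end General

/-! ### Trees with a distinguished vertex, and contraction of subtrees. -/

variable {L : Type} {n b : ℕ}

/-- Trees with a distinguished kind of vertices of arity `n`, the label of any other vertex being
its arity. -/
abbrev VarTree (n : ℕ) (L : Type) : Type := RTree (shapeArity fun _ : Unit => n) L

/-- Every leaf occurs once and there is exactly one distinguished vertex. -/
def VarTree.IsLinear (T : VarTree n L) : Prop := T.vcount (.inl ()) = 1 ∧ ∀ l, T.lcount l = 1

/-- A tree without distinguished vertices. -/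
def ofPlain (n : ℕ) (s : RTree (id : ℕ → ℕ) L) : VarTree n L :=
  s.relabel (m := shapeArity fun _ : Unit => n) Sum.inr fun _ => rfl

theorem ofPlain_leaf (l : L) : ofPlain n (leaf l) = leaf l := rfl

theorem ofPlain_graft {L' : Type} (s : RTree (id : ℕ → ℕ) L) (f : L → RTree (id : ℕ → ℕ) L') :
    ofPlain n (s.graft f) = (ofPlain n s).graft fun l => ofPlain n (f l) :=
  relabel_graft _ _ _ _

theorem lcount_ofPlain (s : RTree (id : ℕ → ℕ) L) (l : L) :
    (ofPlain n s).lcount l = s.lcount l :=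
  lcount_relabel _ _ _ _

theorem vcount_ofPlain (s : RTree (id : ℕ → ℕ) L) (x : Unit) :
    (ofPlain n s).vcount (.inl x) = 0 :=
  vcount_relabel_of_ne (fun _ => Sum.inr_ne_inl) _ _

/-- The trees that are substituted into the vertices in order to replace a marked vertex by the
tree `s`. -/
def fill (n : ℕ) (s : RTree (id : ℕ → ℕ) (Fin b)) :
    ∀ w : Option Unit ⊕ ℕ,
      VarTree n (Fin (shapeArity (optElim b fun _ : Unit => n) w))
  | .inl none => ofPlain n s
  | .inl (some x) => corollaOf (.inl x) rfl
  | .inr k => corollaOf (.inr k) rfl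

theorem lcount_fill {s : RTree (id : ℕ → ℕ) (Fin b)} (hs : ∀ i, s.lcount i = 1)
    (w : Option Unit ⊕ ℕ) (i) : (fill n s w).lcount i = 1 := by
  rcases w with (_ | x) | k
  exacts [(lcount_ofPlain _ _).trans (hs i), lcount_corollaOf _ _ _, lcount_corollaOf _ _ _]

theorem vcount_subst_fill {s : RTree (id : ℕ → ℕ) (Fin b)} (hs : ∀ i, s.lcount i = 1)
    (Q : RTree (shapeArity (optElim b fun _ : Unit => n)) L) :
    (Q.subst (fill n s)).vcount (.inl ()) = Q.vcount (.inl (some ())) := by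
  classical
  refine vcount_subst_of_unique (lcount_fill hs) ?_ Q
  rintro ((_ | x) | k)
  · exact vcount_ofPlain _ _
  · exact (vcount_corollaOf _ _ _).trans (by simp)
  · exact (vcount_corollaOf _ _ _).trans (by simp)

/-- `T'` is obtained from `T` by contraction of a subtree to a vertex. -/
def ContractsTo (T T' : VarTree n L) : Prop :=
  ∃ (b : ℕ) (Q : RTree (shapeArity (optElim b fun _ : Unit => n)) L)
    (s : RTree (id : ℕ → ℕ) (Fin b)), Q.vcount (.inl none) = 1 ∧ (∀ i, s.lcount i = 1) ∧
      Q.subst (fill n s) = T ∧ Q.subst (fill n (corolla b)) = T'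

theorem lcount_corolla_id (i : Fin b) :
    (corolla b : RTree (id : ℕ → ℕ) (Fin b)).lcount i = 1 :=
  lcount_corollaOf (m := id) b rfl i

/-- The number of distinguished vertices and the numbers of leaves can be read off from `Q`,
whichever tree is filled in. -/
theorem ContractsTo.isLinear {T T' : VarTree n L} (h : ContractsTo T T') (hT : T.IsLinear) :
    T'.IsLinear := by
  obtain ⟨b, Q, s, -, hs, rfl, rfl⟩ := h
  have hc : ∀ i, (corolla b : RTree (id : ℕ → ℕ) (Fin b)).lcount i = 1 := lcount_corolla_id
  refine ⟨(vcount_subst_fill hc Q).trans ((vcount_subst_fill hs Q).symm.trans hT.1), fun l => ?_⟩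
  exact (lcount_subst _ (lcount_fill hc) l Q).trans
    ((lcount_subst _ (lcount_fill hs) l Q).symm.trans (hT.2 l))

/-- A tree as a tree with marked vertices, none of which occurs. -/
abbrev mark (b : ℕ) (T : VarTree n L) : RTree (shapeArity (optElim b fun _ : Unit => n)) L :=
  T.relabel (Sum.map some id) (by rintro (_ | _) <;> rfl)

theorem subst_mark (s : RTree (id : ℕ → ℕ) (Fin b)) (T : VarTree n L) :
    (mark b T).subst (fill n s) = T := by
  refine (subst_subst _ _ _).trans (Eq.trans ?_ (subst_id T))
  refine congrArg (fun s => subst s T) (funext fun v => ?_)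
  rcases v with x | k
  exacts [subst_corollaOf (fill n s) (.inl (some x)), subst_corollaOf (fill n s) (.inr k)]

theorem vcount_mark (T : VarTree n L) : (mark b T).vcount (.inl none) = 0 :=
  vcount_relabel_of_ne (by rintro (_ | _) <;> nofun) _ _

/-- The contraction of the subtree `s` at the root. -/
theorem contractsTo_graft {s : RTree (id : ℕ → ℕ) (Fin b)} (hs : ∀ i, s.lcount i = 1)
    (g : Fin b → VarTree n L) :
    ContractsTo ((ofPlain n s).graft g) (node (.inr b) g) := by
  classical
  -- The marked vertex is the root of `Q`; the trees above it contain no marked vertex and are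
  -- unchanged by filling.
  refine ⟨b, node (.inl none) fun i => mark b (g i), s, ?_, hs, ?_, ?_⟩
  · exact (vcount_node _ _ _).trans (congrArg₂ (· + ·) (if_pos rfl)
      (Finset.sum_eq_zero fun i _ => vcount_mark _))
  · simp only [subst, subst_mark]
    rfl
  · simp only [subst, subst_mark]
    rfl

/-- A contraction inside one child is a contraction of the whole tree: take `Q` as the `i`-th child
and siblings in which no vertex is marked. -/
theorem ContractsTo.node {w : Unit ⊕ ℕ} {i : Fin (shapeArity (fun _ : Unit => n) w)}
    {T T' : VarTree n L} (h : ContractsTo T T')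
    (ch : Fin (shapeArity (fun _ : Unit => n) w) → VarTree n L) :
    ContractsTo (node w (Function.update ch i T)) (node w (Function.update ch i T')) := by
  classical
  obtain ⟨b, Q, s, hQ, hs, rfl, rfl⟩ := h
  have key : ∀ r : RTree (id : ℕ → ℕ) (Fin b), ∀ j,
      (Function.update (fun j => mark b (ch j)) i Q j).subst (fill n r) =
        Function.update ch i (Q.subst (fill n r)) j := fun r j => by
    rcases eq_or_ne j i with rfl | hj
    · simp
    · simp [hj, subst_mark]
  have hv : ∑ j, (Function.update (fun j => mark b (ch j)) i Q j).vcount (.inl none) = 1 := by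
    rw [Finset.sum_eq_single i _ (by simp)]
    · simpa using hQ
    · intro j _ hj
      rw [Function.update_of_ne hj]
      exact vcount_mark _
  -- The vertex `w` must be rewritten in the alphabet with marked vertices, as `.inl (some x)` or
  -- `.inr k`.
  rcases w with x | k
  · refine ⟨b, .node (.inl (some x)) (Function.update (fun j => mark b (ch j)) i Q), s,
      ?_, hs, ?_, ?_⟩
    · exact (vcount_node _ _ _).trans (congrArg₂ (· + ·) (if_neg nofun) hv)
    · exact congrArg (RTree.node (n := shapeArity fun _ : Unit => n) (.inl x)) (funext (key s))
    · exact congrArg (RTree.node (n := shapeArity fun _ : Unit => n) (.inl x)) (funext (key _))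
  · refine ⟨b, .node (.inr k) (Function.update (fun j => mark b (ch j)) i Q), s,
      ?_, hs, ?_, ?_⟩
    · exact (vcount_node _ _ _).trans (congrArg₂ (· + ·) (if_neg nofun) hv)
    · exact congrArg (RTree.node (n := shapeArity fun _ : Unit => n) (.inr k)) (funext (key s))
    · exact congrArg (RTree.node (n := shapeArity fun _ : Unit => n) (.inr k)) (funext (key _))

open Relation

theorem reflTransGen_node {w : Unit ⊕ ℕ}
    {A B : Fin (shapeArity (fun _ : Unit => n) w) → VarTree n L}
    (h : ∀ i, ReflTransGen ContractsTo (A i) (B i)) :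
    ReflTransGen ContractsTo (node w A) (node w B) := by
  classical
  -- The children are contracted one at a time; `S` is the set of children already replaced.
  have key : ∀ S : Finset (Fin (shapeArity (fun _ : Unit => n) w)),
      ReflTransGen ContractsTo (node w A) (node w (S.piecewise B A)) := fun S => by
    induction S using Finset.induction_on with
    | empty =>
      rw [Finset.piecewise_empty]
    | insert i S hi ih =>
      refine ih.trans ?_
      rw [Finset.piecewise_insert]
      nth_rewrite 1 [← Function.update_eq_self i (S.piecewise B A)]
      rw [Finset.piecewise_eq_of_notMem _ _ _ hi]
      exact (h i).lift (fun T => node w (Function.update (S.piecewise B A) i T))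
        fun _ _ hT => hT.node _
  simpa using key Finset.univ

/-- A tree whose leaf labels are in the image of an injection is obtained by renaming of
leaves. -/
theorem exists_graft_eq {V : Type} {a : V → ℕ} {g : Fin b → L} (hg : Function.Injective g)
    (t : RTree a L) (h₁ : ∀ i, t.lcount (g i) = 1) (h₀ : ∀ l, l ∉ Set.range g → t.lcount l = 0) :
    ∃ s : RTree a (Fin b), (∀ i, s.lcount i = 1) ∧ s.graft (fun i => leaf (g i)) = t := by
  classical
  obtain ⟨s, rfl⟩ : ∃ s : RTree a (Fin b), s.graft (fun i => leaf (g i)) = t := by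
    -- The hypothesis that each `g i` occurs once does not pass to the children, whereas the absence
    -- of other labels does.
    clear h₁
    induction t with
    | leaf l =>
      obtain ⟨i, rfl⟩ : l ∈ Set.range g := by
        by_contra hl
        simpa [lcount_leaf] using h₀ l hl
      exact ⟨leaf i, rfl⟩
    | node v ch ih =>
      have := fun i => ih i fun l hl =>
        Finset.sum_eq_zero_iff.1 (show ∑ i, (ch i).lcount l = 0 from h₀ l hl) i
          (Finset.mem_univ i)
      choose s hs using this
      exact ⟨node v s, congrArg (node v) (funext hs)⟩
  refine ⟨s, fun i => ?_, rfl⟩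
  have := h₁ i
  simpa [lcount_graft, lcount_leaf, hg.eq_iff] using this

/-! ### Cutting a tree at the distinguished vertex. -/

/-- The tree with the vertices of `C` below and the vertices of `ch i` above the distinguished
vertex. -/
def assemble (C : RTree (id : ℕ → ℕ) (Option L)) (ch : Fin n → RTree (id : ℕ → ℕ) L) :
    VarTree n L :=
  (ofPlain n C).graft fun o => o.elim (node (.inl ()) fun i => ofPlain n (ch i)) leaf

theorem exists_ofPlain_eq (T : VarTree n L) (h : T.vcount (.inl ()) = 0) :
    ∃ s, ofPlain n s = T := by
  classical
  induction T with
  | leaf l => exact ⟨leaf l, rfl⟩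
  | node v ch ih =>
    rw [vcount_node, Nat.add_eq_zero_iff, Finset.sum_eq_zero_iff] at h
    rcases v with x | k
    · simp at h
    · choose s hs using fun i => ih i (h.2 i (Finset.mem_univ i))
      exact ⟨node k s, congrArg (node (n := shapeArity fun _ : Unit => n) (.inr k)) (funext hs)⟩

/-- Descend from the root: at a vertex that is not distinguished, exactly one child contains the
distinguished vertex, and the induction continues there. -/
theorem exists_assemble_eq (T : VarTree n L) (h : T.vcount (.inl ()) = 1) :
    ∃ C ch, assemble C ch = T := by
  classical
  induction T with
  | leaf l => cases h
  | node v ch ih =>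
    rw [vcount_node] at h
    rcases v with x | k
    · rw [if_pos rfl, Nat.add_eq_left, Finset.sum_eq_zero_iff] at h
      choose s hs using fun i => exists_ofPlain_eq (ch i) (h i (Finset.mem_univ i))
      exact ⟨leaf none, s, congrArg (node (n := shapeArity fun _ : Unit => n) (.inl ())) (funext hs)⟩
    · rw [if_neg nofun, zero_add] at h
      obtain ⟨i, hi⟩ : ∃ i, (ch i).vcount (.inl ()) ≠ 0 := by
        by_contra! hc
        rw [Finset.sum_eq_zero fun i _ => hc i] at h
        cases h
      rw [← Finset.add_sum_erase _ _ (Finset.mem_univ i)] at h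
      have h₁ : (ch i).vcount (.inl ()) = 1 := by omega
      have h₀ : ∀ j, j ≠ i → (ch j).vcount (.inl ()) = 0 := fun j hj =>
        Finset.sum_eq_zero_iff.1 (by omega : ∑ j ∈ Finset.univ.erase i,
          (ch j).vcount (.inl ()) = 0) j (Finset.mem_erase.2 ⟨hj, Finset.mem_univ j⟩)
      obtain ⟨C, s, hC⟩ := ih i h₁
      -- The siblings of the child `i` have no distinguished vertex, so they are assembled from a
      -- `D` without the leaf `none`. The family `s` is then irrelevant for them and can be the same
      -- for all children.
      have hr : ∀ j, ∃ D : RTree (id : ℕ → ℕ) (Option L), assemble D s = ch j := fun j => by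
        rcases eq_or_ne j i with rfl | hj
        · exact ⟨C, hC⟩
        · obtain ⟨r, hr⟩ := exists_ofPlain_eq (ch j) (h₀ j hj)
          refine ⟨r.graft fun l => leaf (some l), ?_⟩
          rw [← hr]
          simp only [assemble, ofPlain_graft, ofPlain_leaf, graft_graft]
          exact graft_leaf _
      choose r hr using hr
      exact ⟨node k r, s,
        congrArg (node (n := shapeArity fun _ : Unit => n) (.inr k)) (funext hr)⟩

theorem lcount_node_inl (ch : Fin n → VarTree n L) (l : L) :
    (node (n := shapeArity fun _ : Unit => n) (.inl ()) ch).lcount l =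
      ∑ i : Fin n, (ch i).lcount l := rfl

theorem vcount_assemble [Fintype L] (C : RTree (id : ℕ → ℕ) (Option L))
    (ch : Fin n → RTree (id : ℕ → ℕ) L) :
    (assemble C ch).vcount (.inl ()) = C.lcount none := by
  classical
  rw [assemble, vcount_graft, vcount_ofPlain, Fintype.sum_option]
  simp [vcount_ofPlain, vcount, lcount_ofPlain]

theorem lcount_assemble [Fintype L] (C : RTree (id : ℕ → ℕ) (Option L))
    (ch : Fin n → RTree (id : ℕ → ℕ) L) (l : L) :
    (assemble C ch).lcount l = C.lcount none * ∑ i, (ch i).lcount l + C.lcount (some l) := by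
  classical
  rw [assemble, lcount_graft, Fintype.sum_option]
  simp [lcount_ofPlain, lcount_leaf, lcount_node_inl]

/-- The weight of the `i`-th input of the distinguished vertex. -/
def varWeight {J : Type} (d : J → ℕ) (i : Fin n) :
    ∀ w : Unit ⊕ J, Fin (Sum.elim (fun _ : Unit => n) d w) → ℕ
  | .inl _ => fun j : Fin n => if j = i then 1 else 0
  | .inr _ => fun _ => 0

/-- Passing to the shape keeps the distinguished vertex, the only one of nonzero weight, so the
invariant can be computed on shapes. -/
theorem wsum_shape {J : Type} {d : J → ℕ} (i : Fin n) (l : L)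
    (t : RTree (Sum.elim (fun _ : Unit => n) d) L) :
    t.shape.wsum (varWeight id i) l = t.wsum (varWeight d i) l := by
  rw [wsum_relabel]
  congr 1
  funext w j
  rcases w with x | k <;> rfl

theorem wsum_ofPlain (i : Fin n) (l : L) (s : RTree (id : ℕ → ℕ) L) :
    (ofPlain n s).wsum (varWeight id i) l = 0 := by
  exact (wsum_relabel _ _ _ _ _).trans (wsum_eq_zero (fun _ _ => rfl) _ _)

theorem wsum_node_inl (i : Fin n) (ch : Fin n → VarTree n L) (l : L) :
    (node (n := shapeArity fun _ : Unit => n) (.inl ()) ch).wsum (varWeight id i) l =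
      (ch i).lcount l + ∑ j : Fin n, (ch j).wsum (varWeight id i) l := by
  classical
  change ∑ j : Fin n, ((if j = i then 1 else 0) * (ch j).lcount l + _) = _
  simp [Finset.sum_add_distrib]

theorem wsum_assemble [Fintype L] (C : RTree (id : ℕ → ℕ) (Option L))
    (ch : Fin n → RTree (id : ℕ → ℕ) L) (i : Fin n) (l : L) :
    (assemble C ch).wsum (varWeight id i) l = C.lcount none * (ch i).lcount l := by
  classical
  rw [assemble, wsum_graft, Fintype.sum_option]
  simp [lcount_ofPlain, wsum_ofPlain, wsum, wsum_node_inl]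

/-- Summed over `i`, the weights are 1 on all inputs of the distinguished vertex, so `wsum_le`
applies. In a linear tree this says that a leaf is above at most one input. -/
theorem sum_wsum_varWeight_le {J : Type} {d : J → ℕ} (l : L)
    (t : RTree (Sum.elim (fun _ : Unit => n) d) L) :
    ∑ i, t.wsum (varWeight d i) l ≤ t.vcount (.inl ()) * t.lcount l := by
  classical
  rw [sum_wsum]
  refine wsum_le (fun w j => ?_) l t
  rcases w with x | k
  · change ∑ i : Fin n, (if (show Fin n from j) = i then 1 else 0) ≤ _
    rw [Finset.sum_ite_eq, if_pos (Finset.mem_univ _), if_pos rfl]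
  · simp [varWeight]

/-! ### Normal forms. -/

section NormalForm

variable {m : ℕ} (f : Fin m → Option (Fin n))

/-- The leaves of the root vertex of a normal form. -/
abbrev RootLeaf : Type := {o : Option (Fin m) // ∀ l, o = some l → f l = none}

noncomputable instance : Fintype (RootLeaf f) := Fintype.ofFinite _

noncomputable instance (i : Fin n) : Fintype {l : Fin m // f l = some i} := Fintype.ofFinite _

/-- An enumeration of the inputs of the root vertex of a normal form. -/
noncomputable def rootEnum (x : Fin (Fintype.card (RootLeaf f))) : Option (Fin m) :=
  ((Fintype.equivFin (RootLeaf f)).symm x).1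

/-- An enumeration of the leaves above the `i`-th input of the distinguished vertex. -/
noncomputable def topEnum (i : Fin n) (x : Fin (Fintype.card {l // f l = some i})) : Fin m :=
  ((Fintype.equivFin {l // f l = some i}).symm x).1

theorem rootEnum_injective : Function.Injective (rootEnum f) :=
  Subtype.val_injective.comp (Equiv.injective _)

theorem topEnum_injective (i : Fin n) : Function.Injective (topEnum f i) :=
  Subtype.val_injective.comp (Equiv.injective _)

theorem range_rootEnum : Set.range (rootEnum f) = {o | ∀ l, o = some l → f l = none} := by
  rw [show rootEnum f = Subtype.val ∘ _ from rfl, EquivLike.range_comp]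
  exact Subtype.range_coe

theorem range_topEnum (i : Fin n) : Set.range (topEnum f i) = {l | f l = some i} := by
  rw [show topEnum f i = Subtype.val ∘ _ from rfl, EquivLike.range_comp]
  exact Subtype.range_coe

/-- The part of the normal form below the distinguished vertex. -/
noncomputable def normalRoot : RTree (id : ℕ → ℕ) (Option (Fin m)) :=
  node (Fintype.card (RootLeaf f)) fun x => leaf (rootEnum f x)

/-- The parts of the normal form above the distinguished vertex. -/
noncomputable def normalTop (i : Fin n) : RTree (id : ℕ → ℕ) (Fin m) :=
  node (Fintype.card {l // f l = some i}) fun x => leaf (topEnum f i x)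

theorem lcount_node_leaf {L : Type} [DecidableEq L] {g : Fin b → L}
    (hg : Function.Injective g) (l : L) [Decidable (l ∈ Set.range g)] :
    (node b fun x => leaf (g x) : RTree (id : ℕ → ℕ) L).lcount l =
      if l ∈ Set.range g then 1 else 0 := by
  change ∑ x : Fin b, (leaf (g x) : RTree (id : ℕ → ℕ) L).lcount l = _
  simp only [lcount_leaf]
  split_ifs with h
  · obtain ⟨x, rfl⟩ := h
    simp [hg.eq_iff]
  · exact Finset.sum_eq_zero fun x _ => if_neg fun hx => h ⟨x, hx⟩

theorem lcount_normalRoot (o : Option (Fin m)) [Decidable (∀ l, o = some l → f l = none)] :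
    (normalRoot f).lcount o = if ∀ l, o = some l → f l = none then 1 else 0 := by
  classical
  refine (lcount_node_leaf (rootEnum_injective f) o).trans ?_
  simp only [range_rootEnum, Set.mem_ofPred_eq]

theorem lcount_normalTop (i : Fin n) (l : Fin m) :
    (normalTop f i).lcount l = if f l = some i then 1 else 0 := by
  classical
  refine (lcount_node_leaf (topEnum_injective f i) l).trans ?_
  simp only [range_topEnum, Set.mem_ofPred_eq]

/-- The normal form of the trees in which the `l`-th leaf is above the `i`-th input of the
distinguished vertex if and only if `f l = i`. -/
noncomputable def normalForm : VarTree n (Fin m) := assemble (normalRoot f) (normalTop f)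

theorem lcount_normalRoot_none : (normalRoot f).lcount none = 1 := by
  classical
  rw [lcount_normalRoot, if_pos nofun]

theorem lcount_normalRoot_some (l : Fin m) :
    (normalRoot f).lcount (some l) = if f l = none then 1 else 0 := by
  classical
  rw [lcount_normalRoot]
  simp

theorem sum_ite_eq_some (o : Option (Fin n)) :
    (∑ i, if o = some i then 1 else 0) + (if o = none then 1 else 0) = 1 := by
  rcases o with _ | i <;> simp

theorem isLinear_normalForm : (normalForm f).IsLinear := by
  refine ⟨(vcount_assemble _ _).trans (lcount_normalRoot_none f), fun l => ?_⟩
  rw [normalForm, lcount_assemble, lcount_normalRoot_none, one_mul, lcount_normalRoot_some]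
  simp only [lcount_normalTop]
  exact sum_ite_eq_some _

theorem wsum_normalForm (i : Fin n) (l : Fin m) :
    (normalForm f).wsum (varWeight id i) l = if f l = some i then 1 else 0 := by
  rw [normalForm, wsum_assemble, lcount_normalRoot_none, one_mul, lcount_normalTop]

variable {f}

/-- A plain tree in which each `g x` occurs once and nothing else occurs is, up to renaming of
leaves, a tree `s` with leaves `Fin b`, which contracts to a corolla. This includes `s` a bare edge,
where a unary vertex is created. -/
theorem contractsTo_ofPlain {C : RTree (id : ℕ → ℕ) L} {g : Fin b → L}
    (hg : Function.Injective g) (h : ∀ l, C.lcount l = (node b fun x => leaf (g x) :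
      RTree (id : ℕ → ℕ) L).lcount l) (F : L → VarTree n L') :
    ContractsTo ((ofPlain n C).graft F)
      ((ofPlain n (node b fun x => leaf (g x))).graft F) := by
  classical
  obtain ⟨s, hs, rfl⟩ := exists_graft_eq hg C
    (fun i => by rw [h, lcount_node_leaf hg, if_pos ⟨i, rfl⟩])
    (fun l hl => by rw [h, lcount_node_leaf hg, if_neg hl])
  rw [ofPlain_graft, graft_graft]
  exact contractsTo_graft hs _

/-- Every tree contracts to its normal form. -/
theorem reflTransGen_normalForm {T : VarTree n (Fin m)} (hT : T.IsLinear)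
    (h : ∀ i l, T.wsum (varWeight id i) l = if f l = some i then 1 else 0) :
    ReflTransGen ContractsTo T (normalForm f) := by
  obtain ⟨C, ch, rfl⟩ := exists_assemble_eq T hT.1
  have h₁ : C.lcount none = 1 := (vcount_assemble _ _).symm.trans hT.1
  have h₂ : ∀ i l, (ch i).lcount l = if f l = some i then 1 else 0 := fun i l => by
    rw [← h, wsum_assemble, h₁, one_mul]
  -- By linearity a leaf that is not above the distinguished vertex is a leaf of `C`; thus `f`
  -- determines all leaf counts of `C` and of the `ch i`.
  have h₃ : ∀ l, C.lcount (some l) = if f l = none then 1 else 0 := fun l => by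
    have h' := hT.2 l
    rw [lcount_assemble, h₁, one_mul] at h'
    simp only [h₂] at h'
    have := sum_ite_eq_some (f l)
    omega
  -- One contraction at the root replaces `C` by a single vertex; the trees above the inputs of the
  -- distinguished vertex are contracted afterwards.
  refine ReflTransGen.head (b := assemble (normalRoot f) ch)
    (contractsTo_ofPlain (rootEnum_injective f) (fun o => ?_) _) ?_
  · change _ = (normalRoot f).lcount o
    rcases o with _ | l
    · rw [h₁, lcount_normalRoot_none]
    · rw [h₃, lcount_normalRoot_some]
  · refine reflTransGen_node fun x => ?_
    change ReflTransGen ContractsTo ((rootEnum f x).elim _ _) ((rootEnum f x).elim _ _)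
    rcases rootEnum f x with _ | l
    · refine reflTransGen_node fun i => ReflTransGen.single ?_
      -- Here the contracted tree is all of `ch i`, so nothing is grafted above it except the leaves
      -- themselves.
      have := contractsTo_ofPlain (topEnum_injective f i)
        (fun l => (h₂ i l).trans (lcount_normalTop f i l).symm) (leaf : Fin m → VarTree n _)
      rwa [graft_leaf, graft_leaf] at this
    · exact ReflTransGen.refl

end NormalForm

end RTree

universe u v

/-! ### Substitution after relabelling, and linearity of path weights. -/

namespace RTree

/-- The arities `m (e v)` and `n v` agree only propositionally, so the trees are compared after
renaming the leaves along `Fin.cast`. -/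
theorem subst_relabel {V W X L : Type} {n : V → ℕ} {m : W → ℕ} {k : X → ℕ} {e : V → W}
    {h : ∀ v, m (e v) = n v} {s : ∀ w, RTree k (Fin (m w))} {s' : ∀ v, RTree k (Fin (n v))}
    (hs : ∀ v, (s (e v)).graft (fun i => leaf (Fin.cast (h v) i)) = s' v) (t : RTree n L) :
    (t.relabel e h).subst s = t.subst s' :=
  (subst_subst _ _ _).trans (congrArg (fun s => subst s t) (funext hs))

theorem relabel_subst {V W X L : Type} {n : V → ℕ} {m : W → ℕ} {k : X → ℕ}
    (s : ∀ v, RTree m (Fin (n v))) (e : W → X) (h : ∀ w, k (e w) = m w) (t : RTree n L) :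
    (t.subst s).relabel e h = t.subst fun v => (s v).relabel e h :=
  subst_subst _ _ _

theorem wsum_mul {V L : Type} {n : V → ℕ} (a : ℕ) (ω : ∀ v, Fin (n v) → ℕ) (l : L)
    (t : RTree n L) : t.wsum (fun v j => a * ω v j) l = a * t.wsum ω l := by
  induction t with
  | leaf y => rfl
  | node v ch ih => simp only [wsum, ih, Finset.mul_sum, mul_add, mul_assoc]

/-- A weight supported on the distinguished vertex is a linear combination of the weights of its
single inputs. In a composite, the coefficients are the path weights of the tree put in place of
this vertex. -/
theorem wsum_eq_sum_varWeight {J L : Type} {n : ℕ} {d : J → ℕ}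
    {ω : ∀ w : Unit ⊕ J, Fin (Sum.elim (fun _ : Unit => n) d w) → ℕ}
    (hω : ∀ k j, ω (.inr k) j = 0) (l : L) (t : RTree (Sum.elim (fun _ : Unit => n) d) L) :
    t.wsum ω l = ∑ j : Fin n, ω (.inl ()) j * t.wsum (varWeight d j) l := by
  simp only [← wsum_mul, sum_wsum]
  congr 1
  funext w x
  rcases w with _ | k
  · have h : ∀ (g : Fin n → ℕ) (x : Fin n), g x = ∑ j, g j * (if x = j then 1 else 0) := by simp
    exact h (ω (.inl ())) x
  · simp [hω, varWeight]

end RTree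

theorem SOp.lcount_sub {I K : Type} {c : I → ℕ} {d : K → ℕ} {b : ℕ} {q : RTree d (Fin b)}
    (hq : ∀ i, q.lcount i = 1) (o : Option I) (l) : (sub c q o).lcount l = 1 := by
  rcases o with _ | i
  exacts [(RTree.lcount_relabel _ _ _ _).trans (hq l), RTree.lcount_corollaOf _ _ _]

/-! ### Unary operations of the enveloping operad of `uCom` as partial maps. -/

section UCom

open RTree

variable {n m k : ℕ}

/-- The tree of an expression over `uCom`. -/
def Expr.tree (e : Expr uCom (fun _ : Unit => n) m) :
    RTree (Sum.elim (fun _ : Unit => n) e.d) (Fin m) :=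
  Subtype.val (p := RTree.IsLinear) e.op

theorem Expr.tree_isLinear (e : Expr uCom (fun _ : Unit => n) m) : e.tree.IsLinear :=
  Subtype.property (p := RTree.IsLinear) e.op

theorem Expr.isLinear_shape (e : Expr uCom (fun _ : Unit => n) m) :
    VarTree.IsLinear e.tree.shape :=
  ⟨(vcount_shape_inl _ _).trans (e.tree_isLinear.1 _),
    fun l => (RTree.lcount_relabel _ _ _ l).trans (e.tree_isLinear.2 l)⟩

/-- Equal shapes differ by a bijection between the sets of non-variable vertices, which is a
`relabel` relation since the elements of `uCom` carry no information. -/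
theorem Expr.mk_eq_of_shape_eq {e e' : Expr uCom (fun _ : Unit => n) m}
    (h : e.tree.shape = e'.tree.shape) :
    (Quot.mk _ e : EnvOp uCom Unit (fun _ => n) m) = Quot.mk _ e' := by
  obtain ⟨f, hf, hff⟩ := exists_relabel_eq e.tree_isLinear.1 e'.tree_isLinear.1 h
  exact env_sound f hf (Subtype.ext hff) fun _ => HEq.rfl

/-- Supplies expressions for the normal forms and for the intermediate trees of a chain of
contractions. -/
theorem Expr.exists_shape_eq {T : VarTree n (Fin m)} (hT : T.IsLinear) :
    ∃ e : Expr uCom (fun _ : Unit => n) m, e.tree.shape = T := by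
  obtain ⟨J, _, d, t, ht, rfl⟩ := RTree.exists_shape_eq T fun _ => hT.1
  exact ⟨⟨J, d, ⟨t, ht, fun l => (RTree.lcount_relabel _ _ _ l).symm.trans (hT.2 l)⟩,
    fun _ => ()⟩, rfl⟩

/-- Lifting `Q` and `s` to trees with distinct vertex labels gives operations `q` and `p` of `sOp`,
and the `contract` relation for them has the two given shapes on its sides. -/
theorem Expr.mk_eq_of_contractsTo {e e' : Expr uCom (fun _ : Unit => n) m}
    (h : ContractsTo (n := n) e.tree.shape e'.tree.shape) :
    (Quot.mk _ e : EnvOp uCom Unit (fun _ => n) m) = Quot.mk _ e' := by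
  obtain ⟨b, Q, s, hQ, hs, h₁, h₂⟩ := h
  -- Contraction does not mention linearity of `Q` in the variable and the leaves; it is recovered
  -- from `e`.
  have hQ' : Q.vcount (.inl (some ())) = 1 := by
    rw [← vcount_subst_fill hs, h₁]
    exact e.isLinear_shape.1
  have hQl : ∀ l, Q.lcount l = 1 := fun l => by
    rw [← lcount_subst _ (lcount_fill hs), h₁]
    exact e.isLinear_shape.2 l
  obtain ⟨J, _, d, T, hT, rfl⟩ := RTree.exists_shape_eq Q (by rintro (_ | _); exacts [hQ, hQ'])
  obtain ⟨K, _, lab, S, hS, rfl, -⟩ := exists_lift s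
  have hSl : ∀ i, S.lcount i = 1 := fun i => (RTree.lcount_relabel _ _ _ i).symm.trans (hs i)
  have hTl : ∀ l, T.lcount l = 1 := fun l => (RTree.lcount_relabel _ _ _ l).symm.trans (hQl l)
  let q : sOp.Op (Option (Unit ⊕ J)) (optElim b (Sum.elim (fun _ => n) d)) m :=
    ⟨T.relabel (optSumL Unit J) col_optSumL, SOp.isLinear_relabel _ _ ⟨hT, hTl⟩⟩
  let p : sOp.Op K lab b := ⟨S, hS, hSl⟩
  have key := Quot.sound (Expr.Rel.contract (A := uCom) (c := fun _ : Unit => n) (d := d) q p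
    (fun _ => ()) fun _ => ())
  refine (mk_eq_of_shape_eq ?_).trans (key.trans (mk_eq_of_shape_eq ?_))
  · rw [← h₁]
    -- Both sides are substitutions into the lift `T`, compared vertex by vertex: the marked vertex
    -- receives `s`, and any other vertex receives the corolla labelled by its shape.
    let g : ∀ v : Option Unit ⊕ J, VarTree n (Fin (Sum.elim (optElim b fun _ => n) d v)) :=
      fun v => match v with
        | .inl none => ofPlain n (S.relabel lab fun _ => rfl)
        | .inl (some x) => corollaOf (.inl x) rfl
        | .inr j => corollaOf (.inr (d j)) rfl
    have e₁ : (RTree.shape T).subst (fill n (S.relabel lab fun _ => rfl)) = T.subst g := by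
      refine RTree.subst_relabel ?_ T
      rintro ((_ | x) | j) <;> exact graft_leaf _
    refine e₁.trans (Eq.symm ?_)
    refine (congrArg RTree.shape (relabel_subst _ _ _ _)).trans ?_
    refine (relabel_subst _ _ _ _).trans ?_
    refine RTree.subst_relabel ?_ T
    rintro ((_ | x) | j)
    · refine (graft_leaf _).trans ?_
      refine (congrArg RTree.shape (RTree.relabel_relabel _ _ _ _ _)).trans ?_
      exact (RTree.relabel_relabel _ _ _ _ _).trans (RTree.relabel_relabel (m := id)
        (k := shapeArity fun _ : Unit => n) lab (fun _ => rfl) Sum.inr (fun _ => rfl) S).symm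
    · rfl
    · rfl
  -- Evaluating `p` in `uCom` leaves one vertex of arity `b` in place of the marked one, that is,
  -- the corolla.
  · rw [← h₂]
    refine (congrArg RTree.shape (RTree.relabel_relabel _ _ _ _ _)).trans ?_
    refine (RTree.relabel_relabel _ _ _ _ _).trans (Eq.symm ?_)
    refine RTree.subst_relabel ?_ T
    rintro ((_ | x) | j) <;> exact graft_leaf _

theorem Expr.mk_eq_of_reflTransGen {e e' : Expr uCom (fun _ : Unit => n) m}
    {T : VarTree n (Fin m)} (h : Relation.ReflTransGen (ContractsTo (n := n)) e.tree.shape T)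
    (he' : e'.tree.shape = T) :
    (Quot.mk _ e : EnvOp uCom Unit (fun _ => n) m) = Quot.mk _ e' := by
  induction h generalizing e' with
  | refl => exact mk_eq_of_shape_eq he'.symm
  | @tail T₁ T₂ h₁ h₂ ih =>
    -- Linearity propagates along the chain, so `T₁` is the shape of an expression and the induction
    -- hypothesis applies to it.
    have hT₁ : T₁.IsLinear := by
      clear h₂ ih
      induction h₁ with
      | refl => exact e.isLinear_shape
      | tail _ h ih => exact h.isLinear ih
    obtain ⟨e₁, rfl⟩ := Expr.exists_shape_eq hT₁
    subst he'
    exact (ih rfl).trans (mk_eq_of_contractsTo h₂)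

/-- The number of times that the `l`-th leaf of the tree of an expression is above the `i`-th
input of the vertex that is the variable. -/
noncomputable def Expr.above (e : Expr uCom (fun _ : Unit => n) m) (i : Fin n) (l : Fin m) : ℕ :=
  e.tree.wsum (varWeight e.d i) l

theorem Expr.sum_above_le (e : Expr uCom (fun _ : Unit => n) m) (l : Fin m) :
    ∑ i, e.above i l ≤ 1 :=
  (sum_wsum_varWeight_le l e.tree).trans_eq (by rw [e.tree_isLinear.1, e.tree_isLinear.2])

/-- Relabelling does not touch the variable. In a contraction, the substituted tree `p` has no
variable, so all its paths have weight zero, the same as the vertex that replaces it. -/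
theorem Expr.above_eq_of_rel {e e' : Expr uCom (fun _ : Unit => n) m} (h : Expr.Rel uCom e e')
    (i : Fin n) (l : Fin m) : e.above i l = e'.above i l := by
  rcases h with ⟨f, d, t, a⟩ | ⟨q, p, x, y⟩
  · refine (wsum_relabel _ _ _ _ _).trans ?_
    refine congrArg (fun ω => wsum ω l _) (funext fun w => funext fun j => ?_)
    rcases w with _ | _ <;> rfl
  · refine (wsum_relabel _ _ _ _ _).trans ((wsum_subst _ (SOp.lcount_sub p.2.2) _ _).trans
      (Eq.trans ?_ (wsum_relabel _ _ _ _ _).symm))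
    refine congrArg (fun ω => wsum ω l _) (funext fun w => funext fun j => ?_)
    rcases w with _ | (_ | _)
    · refine (wsum_relabel _ _ _ _ _).trans (wsum_eq_zero (fun _ _ => rfl) _ _)
    · exact wsum_corollaOf _ _ _ _
    · exact wsum_corollaOf _ _ _ _

/-- The number of times that the `l`-th leaf of the tree of an operation is above the `i`-th
input of the vertex that is the variable. -/
noncomputable def EnvOp.above (p : EnvOp uCom Unit (fun _ => n) m) (i : Fin n) (l : Fin m) : ℕ :=
  Quot.lift (fun e => e.above i l) (fun _ _ h => Expr.above_eq_of_rel h i l) p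

open Classical in
/-- The input of the vertex that is the variable which is below a given leaf, if any. -/
noncomputable def EnvOp.leafMap (p : EnvOp uCom Unit (fun _ => n) m) (l : Fin m) :
    Option (Fin n) :=
  if h : ∃ i, p.above i l = 1 then some h.choose else none

/-- The numbers `p.above i l` sum over `i` to at most 1, so at most one of them is 1, and this is
the index chosen by `leafMap`. -/
theorem EnvOp.above_eq_ite (p : EnvOp uCom Unit (fun _ => n) m) (i : Fin n) (l : Fin m) :
    p.above i l = if p.leafMap l = some i then 1 else 0 := by
  have hs : ∑ i, p.above i l ≤ 1 := by
    induction p using Quot.ind with | mk e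
    exact e.sum_above_le l
  have h₁ : ∀ i, p.above i l ≤ 1 := fun i =>
    (Finset.single_le_sum (f := fun i => p.above i l) (fun _ _ => Nat.zero_le _)
      (Finset.mem_univ i)).trans hs
  rw [leafMap]
  split_ifs with h h' h'
  · rw [← Option.some.inj h']
    exact h.choose_spec
  · have hne : i ≠ h.choose := fun hi => h' (congrArg some hi.symm)
    have := Finset.sum_le_sum_of_subset (f := fun i => p.above i l)
      (Finset.subset_univ {i, h.choose})
    rw [Finset.sum_pair hne, h.choose_spec] at this
    omega
  · cases h'
  · have := h₁ i
    have : p.above i l ≠ 1 := fun hi => h ⟨i, hi⟩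
    omega

/-- Operations with the same leaf map contract to the same normal form, represented by `e₀`. -/
theorem EnvOp.leafMap_injective :
    Function.Injective (EnvOp.leafMap : EnvOp uCom Unit (fun _ => n) m → _) := by
  intro p p' h
  obtain ⟨e₀, he₀⟩ := Expr.exists_shape_eq (isLinear_normalForm p.leafMap)
  have key : ∀ p' : EnvOp uCom Unit (fun _ => n) m, p'.leafMap = p.leafMap →
      p' = Quot.mk _ e₀ := fun p' hp' => by
    have ha := p'.above_eq_ite
    rw [hp'] at ha
    induction p' using Quot.ind with | mk e
    refine Expr.mk_eq_of_reflTransGen (reflTransGen_normalForm e.isLinear_shape ?_) he₀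
    exact fun i l => (wsum_shape i l e.tree).trans (ha i l)
  exact (key p rfl).trans (key p' h.symm).symm

theorem EnvOp.leafMap_eq_of_above {p : EnvOp uCom Unit (fun _ => n) m}
    {f : Fin m → Option (Fin n)} (h : ∀ i l, p.above i l = if f l = some i then 1 else 0) :
    p.leafMap = f := by
  funext l
  refine Option.ext fun i => ?_
  have := (p.above_eq_ite i l).symm.trans (h i l)
  by_cases h₁ : p.leafMap l = some i <;> by_cases h₂ : f l = some i <;> simp_all

theorem EnvOp.leafMap_surjective :
    Function.Surjective (EnvOp.leafMap : EnvOp uCom Unit (fun _ => n) m → _) := by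
  intro f
  obtain ⟨e, he⟩ := Expr.exists_shape_eq (isLinear_normalForm f)
  refine ⟨Quot.mk _ e, leafMap_eq_of_above fun i l => ?_⟩
  rw [← wsum_normalForm, ← he]
  exact (wsum_shape i l e.tree).symm

theorem EnvOp.leafMap_one : EnvOp.leafMap (Quot.mk _ (Expr.one uCom n)) = some := by
  refine leafMap_eq_of_above fun i l => ?_
  refine (wsum_relabel _ _ _ _ _).trans ((wsum_corollaOf _ _ _ _).trans ?_)
  change (if l = i then 1 else 0) = _
  simp only [Option.some.injEq]

/-- The tree of `q` replaces the variable of `p`, its leaf `j` becoming the input `j`. A leaf `l` of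
the composite is above the input `i` if, for some `j`, it is above `j` in `p` and `j` is above `i`
in `q`. -/
theorem EnvOp.leafMap_comp (p : EnvOp uCom Unit (fun _ => m) k)
    (q : EnvOp uCom Unit (fun _ => n) m) :
    EnvOp.leafMap (EnvOp.map (Equiv.sumEmpty Unit Empty) (col_sumEmpty (d := fun _ => n))
      (EnvOp.comp (EnvOp.map unitOpt (col_unitOpt (b := m)) p) q)) =
      fun l => (p.leafMap l).bind q.leafMap := by
  refine leafMap_eq_of_above fun i l => ?_
  have key : EnvOp.above (EnvOp.map (Equiv.sumEmpty Unit Empty) (col_sumEmpty (d := fun _ => n))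
      (EnvOp.comp (EnvOp.map unitOpt (col_unitOpt (b := m)) p) q)) i l =
      ∑ j, q.above i j * p.above j l := by
    induction p using Quot.ind with | mk p
    induction q using Quot.ind with | mk q
    -- The weights are pulled back to the tree of `p` through the outer relabellings, the
    -- substitution and the inner relabellings. The result is supported on the variable of `p`, with
    -- weight `q.above i j` at its input `j`.
    refine (wsum_relabel _ _ _ _ _).trans ((wsum_relabel _ _ _ _ _).trans
      ((wsum_subst _ (SOp.lcount_sub q.tree_isLinear.2) _ _).trans
      ((wsum_relabel _ _ _ _ _).trans ((wsum_relabel _ _ _ _ _).trans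
      ((wsum_eq_sum_varWeight (fun x j => ?_) _ _).trans ?_)))))
    · exact wsum_corollaOf _ _ _ _
    · refine Finset.sum_congr rfl fun j _ => congrArg (· * _) ?_
      refine (wsum_relabel _ _ _ _ _).trans ?_
      refine congrArg (fun ω => wsum ω j q.tree) (funext fun w => funext fun x => ?_)
      rcases w with _ | _ <;> rfl
  rw [key]
  simp only [above_eq_ite]
  rcases p.leafMap l with _ | j
  · simp
  · simp

end UCom

/-! ## The isomorphisms of categories -/

theorem areIsomorphic_of_fullyFaithful {C : Type u} [Category.{v} C] {D : Type*} [Category* D]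
    (F : C ⥤ D) [F.Full] [F.Faithful] (hF : Function.Bijective F.obj) : AreIsomorphic C D := by
  let e := Equiv.ofBijective F.obj hF
  have he : ∀ d, F.obj (e.symm d) = d := e.apply_symm_apply
  have he' : ∀ c, e.symm (F.obj c) = c := e.symm_apply_apply
  -- The inverse on objects is inverse only up to a propositional equality, which `eqToHom` corrects
  -- at both ends of a morphism.
  let G : D ⥤ C :=
    { obj := e.symm
      map := fun {a b} f => F.preimage (eqToHom (he a) ≫ f ≫ eqToHom (he b).symm)
      map_id := fun a => F.map_injective (by simp)
      map_comp := fun f g => F.map_injective (by simp) }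
  refine ⟨F, G, CategoryTheory.Functor.ext he' fun a b f => F.map_injective ?_, CategoryTheory.Functor.ext he fun a b f => ?_⟩
  · simp [G, eqToHom_map]
  · simp [G]

/-- The functor from the enveloping category of `uCom` to `Γ`. -/
noncomputable def envelopingToGamma : EnvelopingCategory uCom ⥤ Gamma where
  obj a := ⟨a.colour⟩
  -- The base point `0` corresponds to `none`. A leaf map goes from the leaves, counted by the
  -- target `b`, to the inputs, counted by `a`; this is the direction of the maps that define
  -- morphisms of `Gamma`.
  map {a b} p := ⟨Fin.cases 0 fun l => (finSuccEquiv a.colour).symm (EnvOp.leafMap p l), rfl⟩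
  map_id a := by
    refine Subtype.ext (funext fun l => ?_)
    refine Fin.cases rfl (fun l => ?_) l
    exact congrArg (finSuccEquiv a.colour).symm (congrFun EnvOp.leafMap_one l)
  map_comp {a b c} p q := by
    refine Subtype.ext (funext fun l => ?_)
    refine Fin.cases rfl (fun l => ?_) l
    have h : ∀ (o : Option (Fin b.colour)) (f : Fin b.colour → Option (Fin a.colour)),
        (finSuccEquiv a.colour).symm (o.bind f) =
          Fin.cases (motive := fun _ => Fin (a.colour + 1)) 0
            (fun l => (finSuccEquiv a.colour).symm (f l)) ((finSuccEquiv b.colour).symm o) := by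
      rintro (_ | _) f <;> simp
    exact (congrArg (finSuccEquiv a.colour).symm (congrFun (EnvOp.leafMap_comp q p) l)).trans
      (h _ _)

instance : envelopingToGamma.Faithful where
  map_injective {a b p q} h := by
    refine EnvOp.leafMap_injective (funext fun l => (finSuccEquiv a.colour).symm.injective ?_)
    exact congrFun (congrArg Subtype.val h) l.succ

instance : envelopingToGamma.Full where
  map_surjective {a b} f := by
    obtain ⟨p, hp⟩ := EnvOp.leafMap_surjective fun l => finSuccEquiv a.colour (f.1 (Fin.succ l))
    refine ⟨p, Subtype.ext (funext fun l => ?_)⟩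
    refine Fin.cases f.2.symm (fun l => ?_) l
    exact (congrArg (finSuccEquiv a.colour).symm (congrFun hp l)).trans
      (Equiv.symm_apply_apply _ _)

section TwistedToEnveloping

variable {C : Type*} {Q : Operad C} (A : Algebra Q)

/-- The functor from the twisted arrow category to the enveloping category that sends an element
to its colour. -/
def twistedToEnveloping : TwistedArrowCategory A ⥤ EnvelopingCategory A where
  obj a := ⟨a.colour.1⟩
  map p := p.1
  map_id _ := rfl
  map_comp {a b c} p q := by
    -- Composition in `Algebra.plus` inserts relabellings along identity bijections to match
    -- colours; these are absorbed here.
    let E := envelopingOperad A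
    refine (E.map_map _ _ _ _ _).trans ?_
    refine (congrArg (fun r => E.map _ _ (E.comp r p.1)) (E.map_map _ _ _ _ _)).trans ?_
    exact E.map_comp_congr (Equiv.refl _) (by rintro ⟨⟩) (fun _ => rfl) (fun _ => by
      rename_i x
      rcases x with _ | ⟨⟨⟩⟩
      rfl) _ _

instance : (twistedToEnveloping A).Faithful where
  map_injective h := Subtype.ext h

/-- When the carriers have at most one element, the condition that the evaluation equals the target
holds automatically. -/
theorem twistedToEnveloping_full (hA : ∀ c, Subsingleton (A.carrier c)) :
    (twistedToEnveloping A).Full where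
  map_surjective p := ⟨⟨p, (hA _).elim _ _⟩, rfl⟩

end TwistedToEnveloping

end TwArr

theorem mainTheorem7 :
    TwArr.AreIsomorphic (TwArr.TwistedArrowCategory TwArr.uCom) TwArr.Gamma ∧
      TwArr.AreIsomorphic (TwArr.EnvelopingCategory TwArr.uCom) TwArr.Gamma := by
  have := TwArr.twistedToEnveloping_full TwArr.uCom fun _ => inferInstanceAs (Subsingleton Unit)
  refine ⟨TwArr.areIsomorphic_of_fullyFaithful
    (TwArr.twistedToEnveloping TwArr.uCom ⋙ TwArr.envelopingToGamma) ?_,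
    TwArr.areIsomorphic_of_fullyFaithful TwArr.envelopingToGamma ?_⟩
  -- An object of the twisted arrow category is an arity together with the unique element of `uCom`
  -- of this arity.
  · exact Function.bijective_iff_has_inverse.2
      ⟨fun a => ⟨⟨a.n, ()⟩⟩, fun _ => rfl, fun _ => rfl⟩
  · exact Function.bijective_iff_has_inverse.2
      ⟨fun a => ⟨a.n⟩, fun _ => rfl, fun _ => rfl⟩
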